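/- Let $n\ge 1$, $\gamma>1$, $\bar\varrho,\bar p>0$, $\mathcal R_0,R>0$ and let $k>n$ be real with $\mathcal R_0<\frac{(k-1)R}{k}$. Consider the compressible Euler system for density $\varrho$, velocity $V$, entropy $S$ and pressure $p$ on $\mathbb R^n$, $$\partial_t(\varrho V)+\operatorname{div}(\varrho V\otimes V)+\nabla p=0,\quad \partial_t\varrho+\operatorname{div}(\varrho V)=0,\quad \partial_tS+V\cdot\nabla S=0,\quad p=e^S\varrho^\gamma,$$ with $C^1$ initial data $(V_0,\varrho_0,p_0)$ such that $\varrho_0,p_0>0$ everywhere and $(V_0,\varrho_0,p_0)=(0,\bar\varrho,\bar p)$ for $|x|\ge\mathcal R_0$. Put $B=\frac{k}{R^2(k-1)}$, $C=B(k-1)$, and let $$\phi(r)=1-Br^2\ \ (0\le r< R-\tfrac Rk),\qquad \phi(r)=C(r-R)^2\ \ (R-\tfrac Rk\le r\le R),\qquad \phi(r)=0\ \ (r>R).$$ Put $G_\phi(t)=\int_{\mathbb R^n}\varrho(t,x)\,\phi(|x|)\,dx$, so that $G_\phi(0)=\int\varrho_0\,\phi(|x|)\,dx$, and $$G_\phi'(0)=\int_{\mathbb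 R^n}\frac{\phi'(|x|)}{|x|}\,(V_0\cdot x)\,\varrho_0\,dx .$$ Let $\delta=\min\{2,n(\gamma-1)\}$, let $\omega_n$ be the volume of the unit ball of $\mathbb R^n$, $\sigma=\sqrt{\gamma\bar p/\bar\varrho}$, and $$e(0)=\frac12\int_{\mathbb R^n}\varrho_0|V_0|^2dx+\frac1{\gamma-1}\int_{|x|<\mathcal R_0}(p_0-\bar p)\,dx,\qquad N=\delta\, e(0)+\omega_nR^n\bar p\Big(\frac{k-1}{k}\Big)^n\Big(\frac{\delta}{\gamma-1}-n\Big),$$ $$T_1=\frac{1}{2BN}\Big(G_\phi'(0)+\sqrt{(G_\phi'(0))^2+4BN\,G_\phi(0)}\Big),\qquad T_2=\frac1\sigma\Big(\frac{(k-1)R}{k}-\mathcal R_0\Big),$$ where for $N=0$ one sets $T_1=-G_\phi(0)/G_\phi'(0)$ (which requires $G_\phi'(0)\neq0$), and where the expression under the root is assumed to be nonnegative. Suppose that $0<T_1\le T_2$. Then the solution of the Cauchy problem loses its smoothness within time $T_1$ inside the ball $\mathcal B_R=\{|x|\le R\}$. Precisely, for every $\tau>0$ and every $C^1$ solution on $[0,\tau)\times\mathbb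 R^n$ with these data: the number $G_\phi'(0)$ above is the right derivative of $G_\phi$ at $t=0$; $\tau\le T_1$; if $\tau=T_1$, then $(\varrho,V,p)$ does not extend to a $C^1$ function on $[0,T_1]\times\mathcal B_R$; and if $(\varrho,V,p)$ does not extend to a $C^1$ function on $[0,\tau]\times\mathbb R^n$, then it does not extend to a $C^1$ function on $[0,\tau]\times\mathcal B_R$. -/

import Mathlib

open Set MeasureTheory

noncomputable section

namespace EulerMoment

/-- Euclidean space of dimension `n`. -/
abbrev Sp (n : ℕ) : Type := EuclideanSpace ℝ (Fin n)

/-- The unknowns of the system as functions of time and position: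
density, velocity, entropy and pressure. -/
structure Flow (n : ℕ) where
  ρ : ℝ → Sp n → ℝ
  V : ℝ → Sp n → Sp n
  S : ℝ → Sp n → ℝ
  p : ℝ → Sp n → ℝ

/-- Initial density, velocity and pressure. -/
structure Data (n : ℕ) where
  ρ₀ : Sp n → ℝ
  V₀ : Sp n → Sp n
  p₀ : Sp n → ℝ

/-- The `j`-th partial derivative of a scalar function on `ℝⁿ`. -/
def pd {n : ℕ} (j : Fin n) (f : Sp n → ℝ) (x : Sp n) : ℝ :=
  fderiv ℝ f x (EuclideanSpace.single j 1)

/-- `u` is a `C¹` solution on `[0, τ) × ℝⁿ` of the compressible Euler system with heat ratio `γ`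
and initial data `d`. The functions are `C¹` up to `t = 0`; the equations are imposed for
`0 < t < τ` and hence hold, by continuity, with one-sided time derivatives also at `t = 0`. -/
structure IsClassicalSolution {n : ℕ} (γ τ : ℝ) (d : Data n) (u : Flow n) : Prop where
  smooth_ρ : ContDiffOn ℝ 1 (fun z : ℝ × Sp n => u.ρ z.1 z.2) (Ico 0 τ ×ˢ univ)
  smooth_V : ContDiffOn ℝ 1 (fun z : ℝ × Sp n => u.V z.1 z.2) (Ico 0 τ ×ˢ univ)
  smooth_S : ContDiffOn ℝ 1 (fun z : ℝ × Sp n => u.S z.1 z.2) (Ico 0 τ ×ˢ univ)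
  smooth_p : ContDiffOn ℝ 1 (fun z : ℝ × Sp n => u.p z.1 z.2) (Ico 0 τ ×ˢ univ)
  momentum : ∀ t ∈ Ioo 0 τ, ∀ x : Sp n, ∀ i : Fin n,
    deriv (fun s => u.ρ s x * u.V s x i) t
      + ∑ j : Fin n, pd j (fun y => u.ρ t y * u.V t y i * u.V t y j) x
      + pd i (u.p t) x = 0
  mass : ∀ t ∈ Ioo 0 τ, ∀ x : Sp n,
    deriv (fun s => u.ρ s x) t + ∑ j : Fin n, pd j (fun y => u.ρ t y * u.V t y j) x = 0
  entropy : ∀ t ∈ Ioo 0 τ, ∀ x : Sp n,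
    deriv (fun s => u.S s x) t + ∑ j : Fin n, u.V t x j * pd j (u.S t) x = 0
  state : ∀ t ∈ Ico 0 τ, ∀ x : Sp n, u.p t x = Real.exp (u.S t x) * u.ρ t x ^ γ
  init_ρ : ∀ x, u.ρ 0 x = d.ρ₀ x
  init_V : ∀ x, u.V 0 x = d.V₀ x
  init_p : ∀ x, u.p 0 x = d.p₀ x

/-- The solution `u`, given on `[0, τ) × ℝⁿ`, stays smooth in `Ω` up to and including the time `τ`:
density, velocity and pressure extend to `C¹` functions on `[0, τ] × Ω`. -/
def SmoothUpTo {n : ℕ} (u : Flow n) (τ : ℝ) (Ω : Set (Sp n)) : Prop :=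
  ∃ w : Flow n,
    ContDiffOn ℝ 1 (fun z : ℝ × Sp n => w.ρ z.1 z.2) (Icc 0 τ ×ˢ Ω) ∧
    ContDiffOn ℝ 1 (fun z : ℝ × Sp n => w.V z.1 z.2) (Icc 0 τ ×ˢ Ω) ∧
    ContDiffOn ℝ 1 (fun z : ℝ × Sp n => w.p z.1 z.2) (Icc 0 τ ×ˢ Ω) ∧
    ∀ t ∈ Ico 0 τ, ∀ x ∈ Ω, w.ρ t x = u.ρ t x ∧ w.V t x = u.V t x ∧ w.p t x = u.p t x

/-- Smooth positive data that coincide with the constant state `(ρ, V, p) = (ρbar, 0, pbar)`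
outside the open ball of radius `R₀` about the origin. -/
structure IsPerturbation {n : ℕ} (ρbar pbar R₀ : ℝ) (d : Data n) : Prop where
  smooth_ρ : ContDiff ℝ 1 d.ρ₀
  smooth_V : ContDiff ℝ 1 d.V₀
  smooth_p : ContDiff ℝ 1 d.p₀
  pos_ρ : ∀ x, 0 < d.ρ₀ x
  pos_p : ∀ x, 0 < d.p₀ x
  far : ∀ x, x ∉ Metric.ball (0 : Sp n) R₀ → d.ρ₀ x = ρbar ∧ d.V₀ x = 0 ∧ d.p₀ x = pbar

/-- The constant `B = k / (R² (k - 1))`. -/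
def Bc (R k : ℝ) : ℝ := k / (R ^ 2 * (k - 1))

/-- The constant `C = B (k - 1)`. -/
def Cc (R k : ℝ) : ℝ := Bc R k * (k - 1)

/-- The radial profile of the moment function. -/
def phi (R k r : ℝ) : ℝ :=
  if r < R - R / k then 1 - Bc R k * r ^ 2
  else if r ≤ R then Cc R k * (r - R) ^ 2
  else 0

/-- The moment `∫ ρ φ(|x|) dx` of a density. -/
def moment {n : ℕ} (R k : ℝ) (ρ : Sp n → ℝ) : ℝ :=
  ∫ x : Sp n, ρ x * phi R k ‖x‖

/-- The integral `∫ (φ'(|x|) / |x|) (V · x) ρ dx`. -/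
def momentRate {n : ℕ} (R k : ℝ) (ρ : Sp n → ℝ) (V : Sp n → Sp n) : ℝ :=
  ∫ x : Sp n, deriv (phi R k) ‖x‖ / ‖x‖ * inner ℝ (V x) x * ρ x

/-- `δ = min {2, n (γ - 1)}`. -/
def delta (n : ℕ) (γ : ℝ) : ℝ := min 2 (n * (γ - 1))

/-- The volume of the unit ball of `ℝⁿ`. -/
def omega (n : ℕ) : ℝ := (volume (Metric.ball (0 : Sp n) 1)).toReal

/-- The excess energy of the data over the constant state. -/
def excessEnergy {n : ℕ} (γ pbar R₀ : ℝ) (d : Data n) : ℝ :=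
  (1 / 2) * (∫ x : Sp n, d.ρ₀ x * ‖d.V₀ x‖ ^ 2)
    + 1 / (γ - 1) * ∫ x in Metric.ball (0 : Sp n) R₀, (d.p₀ x - pbar)

/-- The constant `N`. -/
def Nc {n : ℕ} (γ pbar R₀ R k : ℝ) (d : Data n) : ℝ :=
  delta n γ * excessEnergy γ pbar R₀ d
    + omega n * R ^ n * pbar * ((k - 1) / k) ^ n * (delta n γ / (γ - 1) - n)

/-- The expression under the square root in `T₁`. -/
def disc (B N G₀ G₁ : ℝ) : ℝ := G₁ ^ 2 + 4 * B * N * G₀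

/-- The time `T₁`; for `N = 0` it is the limit of the general expression as `N → 0`
(for `G₁ < 0`; for `N = 0` and `G₁ ≥ 0` the value is not positive). -/
def T₁ (B N G₀ G₁ : ℝ) : ℝ :=
  if N = 0 then -G₀ / G₁
  else 1 / (2 * B * N) * (G₁ + Real.sqrt (disc B N G₀ G₁))

/-- The sound speed `√(∂p/∂ρ)` of the constant state. -/
def soundSpeed (γ ρbar pbar : ℝ) : ℝ := Real.sqrt (γ * pbar / ρbar)

/-- The time `T₂` before which a signal of speed `σ` starting in the ball of radius `R₀` stays in
the ball of radius `(k - 1) R / k`. -/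
def T₂ (σ R₀ R k : ℝ) : ℝ := 1 / σ * ((k - 1) * R / k - R₀)

end EulerMoment

end

namespace EulerMoment

open Filter Topology

section Calculus

variable {n : ℕ}

theorem isOpen_Ioo_prod_univ (a b : ℝ) : IsOpen (Ioo a b ×ˢ (univ : Set (Sp n))) :=
  isOpen_Ioo.prod isOpen_univ

theorem uniqueDiffOn_Ico_prod_univ (τ : ℝ) :
    UniqueDiffOn ℝ (Ico 0 τ ×ˢ (univ : Set (Sp n))) :=
  (uniqueDiffOn_Ico 0 τ).prod uniqueDiffOn_univ

theorem contDiffAt_of_contDiffOn_Ico {E : Type*} [NormedAddCommGroup E] [NormedSpace ℝ E]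
    {τ : ℝ} {F : ℝ × Sp n → E} (hF : ContDiffOn ℝ 1 F (Ico 0 τ ×ˢ univ))
    {t : ℝ} (ht : t ∈ Ioo 0 τ) (x : Sp n) : ContDiffAt ℝ 1 F (t, x) :=
  hF.contDiffAt (mem_of_superset ((isOpen_Ioo_prod_univ 0 τ).mem_nhds ⟨ht, mem_univ x⟩)
    (prod_mono Ioo_subset_Ico_self subset_rfl))

theorem contDiffOn_coord {τ : ℝ} {V : ℝ → Sp n → Sp n}
    (hV : ContDiffOn ℝ 1 (fun z : ℝ × Sp n => V z.1 z.2) (Ico 0 τ ×ˢ univ)) (i : Fin n) :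
    ContDiffOn ℝ 1 (fun z : ℝ × Sp n => V z.1 z.2 i) (Ico 0 τ ×ˢ univ) :=
  contDiffOn_euclidean.1 hV i

theorem contDiff_slice {E : Type*} [NormedAddCommGroup E] [NormedSpace ℝ E]
    {τ : ℝ} {f : ℝ → Sp n → E}
    (hf : ContDiffOn ℝ 1 (fun z : ℝ × Sp n => f z.1 z.2) (Ico 0 τ ×ˢ univ))
    {t : ℝ} (ht : t ∈ Ico 0 τ) : ContDiff ℝ 1 (f t) := by
  rw [← contDiffOn_univ]
  exact hf.comp (f := fun x : Sp n => (t, x)) (by fun_prop) (fun x _ => ⟨ht, mem_univ x⟩)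

theorem hasDerivAt_time {E : Type*} [NormedAddCommGroup E] [NormedSpace ℝ E]
    {τ : ℝ} {f : ℝ → Sp n → E}
    (hf : ContDiffOn ℝ 1 (fun z : ℝ × Sp n => f z.1 z.2) (Ico 0 τ ×ˢ univ))
    {t : ℝ} (ht : t ∈ Ioo 0 τ) (x : Sp n) :
    HasDerivAt (fun s => f s x) (fderiv ℝ (fun z : ℝ × Sp n => f z.1 z.2) (t, x) (1, 0)) t := by
  have h1 := ((contDiffAt_of_contDiffOn_Ico hf ht x).differentiableAt (by simp)).hasFDerivAt
  have h2 : HasDerivAt (fun s : ℝ => (s, x)) ((1 : ℝ), (0 : Sp n)) t :=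
    (hasDerivAt_id t).prodMk (hasDerivAt_const t x)
  exact h1.comp_hasDerivAt t h2

theorem differentiableAt_time {E : Type*} [NormedAddCommGroup E] [NormedSpace ℝ E]
    {τ : ℝ} {f : ℝ → Sp n → E}
    (hf : ContDiffOn ℝ 1 (fun z : ℝ × Sp n => f z.1 z.2) (Ico 0 τ ×ˢ univ))
    {t : ℝ} (ht : t ∈ Ioo 0 τ) (x : Sp n) : DifferentiableAt ℝ (fun s => f s x) t :=
  (hasDerivAt_time hf ht x).differentiableAt

/-- Spatial partial derivatives of a `C¹` function are continuous up to the initial time. -/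
theorem continuousOn_pd {τ : ℝ} {f : ℝ → Sp n → ℝ}
    (hf : ContDiffOn ℝ 1 (fun z : ℝ × Sp n => f z.1 z.2) (Ico 0 τ ×ˢ univ)) (j : Fin n) :
    ContinuousOn (fun z : ℝ × Sp n => pd j (f z.1) z.2) (Ico 0 τ ×ˢ univ) := by
  have h1 := hf.continuousOn_fderivWithin (uniqueDiffOn_Ico_prod_univ τ) le_rfl
  have h2 : ContinuousOn (fun z : ℝ × Sp n => fderivWithin ℝ (fun z : ℝ × Sp n => f z.1 z.2)
      (Ico 0 τ ×ˢ univ) z ((0 : ℝ), EuclideanSpace.single j (1 : ℝ))) (Ico 0 τ ×ˢ univ) :=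
    h1.clm_apply continuousOn_const
  refine h2.congr fun z hz => ?_
  have h3 := (hf.differentiableOn (by simp) z hz).hasFDerivWithinAt
  have h4 : HasFDerivWithinAt (fun x : Sp n => (z.1, x))
      (ContinuousLinearMap.inr ℝ ℝ (Sp n)) univ z.2 :=
    (hasFDerivAt_prodMk_right z.1 z.2).hasFDerivWithinAt
  have h5 := h3.comp z.2 h4
    (show MapsTo _ univ (Ico 0 τ ×ˢ univ) from fun x _ => ⟨hz.1, mem_univ x⟩)
  rw [hasFDerivWithinAt_univ] at h5
  have h6 : fderiv ℝ (f z.1) z.2 = _ := h5.fderiv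
  simp [pd, h6]

theorem integral_pd_eq_zero {f : Sp n → ℝ} (hf : ContDiff ℝ 1 f) (hs : HasCompactSupport f)
    (j : Fin n) : ∫ x, pd j f x = 0 := by
  have hc : Continuous fun x => fderiv ℝ f x (EuclideanSpace.single j (1 : ℝ)) :=
    (hf.continuous_fderiv (by simp)).clm_apply continuous_const
  have hi : Integrable (fun x => fderiv ℝ f x (EuclideanSpace.single j (1 : ℝ))) :=
    hc.integrable_of_hasCompactSupport (hs.fderiv_apply ℝ _)
  have := integral_mul_fderiv_eq_neg_fderiv_mul_of_integrable (μ := (volume : Measure (Sp n)))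
    (f := fun _ => (1 : ℝ)) (g := f) (v := EuclideanSpace.single j (1 : ℝ))
    (by simp) (by simpa using hi)
    (by simpa using hf.continuous.integrable_of_hasCompactSupport hs)
    (fun _ _ => differentiableAt_const _) (fun x _ => hf.differentiable (by simp) x)
  simpa [pd] using this

theorem integrable_of_eq_zero_off_compact {f : Sp n → ℝ} (hf : Continuous f) {K : Set (Sp n)}
    (hK : IsCompact K) (h0 : ∀ x, x ∉ K → f x = 0) : Integrable f :=
  hf.integrable_of_hasCompactSupport (HasCompactSupport.intro hK h0)

theorem hasDerivAt_integral_of_compact_support {τ : ℝ} {f : ℝ → Sp n → ℝ} {K : Set (Sp n)}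
    (hK : IsCompact K) (hf : ContDiffOn ℝ 1 (fun z : ℝ × Sp n => f z.1 z.2) (Ico 0 τ ×ˢ univ))
    (h0 : ∀ t ∈ Ioo 0 τ, ∀ x, x ∉ K → f t x = 0) {t : ℝ} (ht : t ∈ Ioo 0 τ) :
    Integrable (fun x => deriv (fun s => f s x) t) ∧
    HasDerivAt (fun s => ∫ x, f s x) (∫ x, deriv (fun s => f s x) t) t := by
  obtain ⟨ε, hε, hball⟩ := Metric.nhds_basis_closedBall.mem_iff.1 (Ioo_mem_nhds ht.1 ht.2)
  set F : ℝ × Sp n → ℝ := fun z => f z.1 z.2 with hF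
  have hcF : ContinuousOn (fun z : ℝ × Sp n => fderiv ℝ F z ((1 : ℝ), (0 : Sp n)))
      (Ioo 0 τ ×ˢ univ) :=
    ((hf.mono (prod_mono Ioo_subset_Ico_self subset_rfl)).continuousOn_fderiv_of_isOpen
      (isOpen_Ioo_prod_univ 0 τ) le_rfl).clm_apply continuousOn_const
  obtain ⟨C, hC⟩ := ((isCompact_closedBall t ε).prod hK).exists_bound_of_continuousOn
    (hcF.mono (prod_mono hball (subset_univ K)))
  have hd : ∀ s ∈ Ioo 0 τ, ∀ x, deriv (fun s => f s x) s = fderiv ℝ F (s, x) (1, 0) :=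
    fun s hs x => (hasDerivAt_time hf hs x).deriv
  have hcont : ∀ s ∈ Ioo 0 τ, Continuous (f s) := fun s hs =>
    (contDiff_slice hf (Ioo_subset_Ico_self hs)).continuous
  refine hasDerivAt_integral_of_dominated_loc_of_deriv_le (μ := (volume : Measure (Sp n)))
    (F := f) (F' := fun s x => deriv (fun s => f s x) s) (bound := K.indicator fun _ => C)
    (s := Metric.closedBall t ε) (Metric.closedBall_mem_nhds t hε) ?_ ?_ ?_ ?_ ?_ ?_
  · filter_upwards [Ioo_mem_nhds ht.1 ht.2] with s hs
    exact (hcont s hs).aestronglyMeasurable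
  · exact integrable_of_eq_zero_off_compact (hcont t ht) hK (h0 t ht)
  · have : Continuous fun x => deriv (fun s => f s x) t := by
      rw [show (fun x => deriv (fun s => f s x) t) = fun x => fderiv ℝ F (t, x) (1, 0) from
        funext (hd t ht)]
      exact hcF.comp_continuous (f := fun x : Sp n => (t, x)) (by fun_prop)
        (fun x => ⟨ht, mem_univ x⟩)
    exact this.aestronglyMeasurable
  · refine Eventually.of_forall fun x s hs => ?_
    by_cases hx : x ∈ K
    · rw [indicator_of_mem hx, hd s (hball hs)]
      exact hC (s, x) ⟨hs, hx⟩
    · rw [indicator_of_notMem hx]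
      have : (fun s => f s x) =ᶠ[𝓝 s] fun _ => 0 := by
        filter_upwards [Ioo_mem_nhds (hball hs).1 (hball hs).2] with r hr
        exact h0 r hr x hx
      simp [this.deriv_eq]
  · exact (integrable_indicator_iff hK.isClosed.measurableSet).2
      (integrableOn_const hK.measure_lt_top.ne)
  · exact Eventually.of_forall fun x s hs =>
      (differentiableAt_time hf (hball hs) x).hasDerivAt

/-- Integrated form of a balance law `∂ₜ a + div b = c` with compactly supported terms. -/
theorem hasDerivAt_integral_of_balance {τ : ℝ} {a : ℝ → Sp n → ℝ} {c : Sp n → ℝ}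
    {b : Fin n → ℝ → Sp n → ℝ} {K : Set (Sp n)} (hK : IsCompact K)
    (ha : ContDiffOn ℝ 1 (fun z : ℝ × Sp n => a z.1 z.2) (Ico 0 τ ×ˢ univ))
    (hb : ∀ j, ContDiffOn ℝ 1 (fun z : ℝ × Sp n => b j z.1 z.2) (Ico 0 τ ×ˢ univ))
    (ha0 : ∀ t ∈ Ioo 0 τ, ∀ x, x ∉ K → a t x = 0)
    (hb0 : ∀ j, ∀ t ∈ Ioo 0 τ, ∀ x, x ∉ K → b j t x = 0) {t : ℝ} (ht : t ∈ Ioo 0 τ)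
    (h : ∀ x, deriv (fun s => a s x) t + ∑ j, pd j (b j t) x = c x) :
    Integrable c ∧ HasDerivAt (fun s => ∫ x, a s x) (∫ x, c x) t := by
  obtain ⟨h1, h2⟩ := hasDerivAt_integral_of_compact_support hK ha ha0 ht
  have hbt : ∀ j, ContDiff ℝ 1 (b j t) := fun j =>
    contDiff_slice (hb j) (Ioo_subset_Ico_self ht)
  have hcs : ∀ j, HasCompactSupport (b j t) := fun j => HasCompactSupport.intro hK (hb0 j t ht)
  have h3 : ∀ j ∈ Finset.univ, Integrable (fun x => pd j (b j t) x) := fun j _ =>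
    (((hbt j).continuous_fderiv (by simp)).clm_apply
      continuous_const).integrable_of_hasCompactSupport ((hcs j).fderiv_apply ℝ _)
  have h4 : ∫ x, c x = ∫ x, deriv (fun s => a s x) t := by
    calc ∫ x, c x = ∫ x, (deriv (fun s => a s x) t + ∑ j, pd j (b j t) x) :=
          integral_congr_ae (Eventually.of_forall fun x => (h x).symm)
      _ = (∫ x, deriv (fun s => a s x) t) + ∫ x, ∑ j, pd j (b j t) x :=
          integral_add h1 (integrable_finsetSum _ h3)
      _ = ∫ x, deriv (fun s => a s x) t := by
          rw [integral_finsetSum _ h3]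
          simp [integral_pd_eq_zero (hbt _) (hcs _)]
  refine ⟨?_, by rwa [h4]⟩
  rw [show c = fun x => deriv (fun s => a s x) t + ∑ j, pd j (b j t) x from
    funext fun x => (h x).symm]
  exact h1.add (integrable_finsetSum _ h3)

theorem pd_mul {f g : Sp n → ℝ} {x : Sp n} (j : Fin n) (hf : DifferentiableAt ℝ f x)
    (hg : DifferentiableAt ℝ g x) :
    pd j (fun y => f y * g y) x = pd j f x * g x + f x * pd j g x := by
  simp only [pd]
  rw [fderiv_fun_mul hf hg]
  simp
  ring

theorem pd_add {f g : Sp n → ℝ} {x : Sp n} (j : Fin n) (hf : DifferentiableAt ℝ f x)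
    (hg : DifferentiableAt ℝ g x) :
    pd j (fun y => f y + g y) x = pd j f x + pd j g x := by
  simp only [pd]
  rw [fderiv_fun_add hf hg]
  simp

theorem pd_sub_const {f : Sp n → ℝ} {x : Sp n} (j : Fin n) (c : ℝ) :
    pd j (fun y => f y - c) x = pd j f x := by
  simp only [pd]
  rw [fderiv_sub_const]

theorem pd_const_mul {f : Sp n → ℝ} {x : Sp n} (j : Fin n) (c : ℝ)
    (hf : DifferentiableAt ℝ f x) :
    pd j (fun y => c * f y) x = c * pd j f x := by
  simp only [pd]
  rw [fderiv_const_mul hf]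
  simp

theorem pd_sum {ι : Type*} {s : Finset ι} {f : ι → Sp n → ℝ} {x : Sp n} (j : Fin n)
    (hf : ∀ i ∈ s, DifferentiableAt ℝ (f i) x) :
    pd j (fun y => ∑ i ∈ s, f i y) x = ∑ i ∈ s, pd j (f i) x := by
  simp only [pd]
  rw [fderiv_fun_sum hf]
  simp

theorem pd_coord (i j : Fin n) (x : Sp n) :
    pd j (fun y => y i) x = if i = j then 1 else 0 := by
  have h : HasFDerivAt (fun y : Sp n => y i) (EuclideanSpace.proj (𝕜 := ℝ) i) x :=
    (EuclideanSpace.proj (𝕜 := ℝ) (ι := Fin n) i).hasFDerivAt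
  simp [pd, h.fderiv]

theorem pd_norm_sq (j : Fin n) (x₀ x : Sp n) :
    pd j (fun y => ‖y - x₀‖ ^ 2) x = 2 * (x j - x₀ j) := by
  have h : HasFDerivAt (fun y : Sp n => ‖y - x₀‖ ^ 2) _ x :=
    ((hasFDerivAt_id x).sub_const x₀).norm_sq
  simp only [pd, h.fderiv]
  simp [EuclideanSpace.inner_single_right]

end Calculus

section Pointwise

variable {n : ℕ} {γ τ : ℝ} {d : Data n} {u : Flow n}

/-- `f` is a `C¹` function on `[0, τ) × ℝⁿ`. -/
abbrev C1 {n : ℕ} (τ : ℝ) (f : ℝ → Sp n → ℝ) : Prop :=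
  ContDiffOn ℝ 1 (fun z : ℝ × Sp n => f z.1 z.2) (Ico 0 τ ×ˢ univ)

theorem C1.mono {σ : ℝ} {f : ℝ → Sp n → ℝ} (hf : C1 τ f) (h : σ ≤ τ) : C1 σ f :=
  ContDiffOn.mono hf (prod_mono (Ico_subset_Ico_right h) subset_rfl)

/-- The divergence of a vector field. -/
noncomputable def divergence {n : ℕ} (W : Sp n → Sp n) (x : Sp n) : ℝ :=
  ∑ j, pd j (fun y => W y j) x

/-- The derivative of `f` along the flow of the velocity field `V`. -/
noncomputable def material {n : ℕ} (V : ℝ → Sp n → Sp n) (f : ℝ → Sp n → ℝ) (t : ℝ) (x : Sp n) :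
    ℝ :=
  deriv (fun s => f s x) t + ∑ j, V t x j * pd j (f t) x

theorem C1.pd_diff {f : ℝ → Sp n → ℝ} (hf : C1 τ f) {t : ℝ} (ht : t ∈ Ioo 0 τ) (x : Sp n) :
    DifferentiableAt ℝ (f t) x :=
  (contDiff_slice hf (Ioo_subset_Ico_self ht)).differentiable (by simp) x

theorem material_mul (V : ℝ → Sp n → Sp n) {f g : ℝ → Sp n → ℝ} (hf : C1 τ f) (hg : C1 τ g)
    {t : ℝ} (ht : t ∈ Ioo 0 τ) (x : Sp n) :
    material V (fun t x => f t x * g t x) t x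
      = material V f t x * g t x + f t x * material V g t x := by
  simp only [material]
  rw [deriv_fun_mul (differentiableAt_time hf ht x) (differentiableAt_time hg ht x)]
  simp only [pd_mul _ (hf.pd_diff ht x) (hg.pd_diff ht x), mul_add, add_mul, Finset.sum_add_distrib,
    Finset.sum_mul, Finset.mul_sum]
  have h1 : ∀ j, V t x j * (pd j (f t) x * g t x) = V t x j * pd j (f t) x * g t x :=
    fun j => by ring
  have h2 : ∀ j, V t x j * (f t x * pd j (g t) x) = f t x * (V t x j * pd j (g t) x) :=
    fun j => by ring
  simp only [h1, h2]
  ring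

theorem material_add (V : ℝ → Sp n → Sp n) {f g : ℝ → Sp n → ℝ} (hf : C1 τ f) (hg : C1 τ g)
    {t : ℝ} (ht : t ∈ Ioo 0 τ) (x : Sp n) :
    material V (fun t x => f t x + g t x) t x = material V f t x + material V g t x := by
  simp only [material]
  rw [deriv_fun_add (differentiableAt_time hf ht x) (differentiableAt_time hg ht x)]
  simp only [pd_add _ (hf.pd_diff ht x) (hg.pd_diff ht x), mul_add, Finset.sum_add_distrib]
  ring

theorem material_sub_const (V : ℝ → Sp n → Sp n) (f : ℝ → Sp n → ℝ) (c t : ℝ) (x : Sp n) :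
    material V (fun t x => f t x - c) t x = material V f t x := by
  simp [material, pd_sub_const]

theorem material_const_mul (V : ℝ → Sp n → Sp n) {f : ℝ → Sp n → ℝ} (hf : C1 τ f) (c : ℝ)
    {t : ℝ} (ht : t ∈ Ioo 0 τ) (x : Sp n) :
    material V (fun t x => c * f t x) t x = c * material V f t x := by
  simp only [material]
  rw [deriv_const_mul _ (differentiableAt_time hf ht x)]
  simp only [pd_const_mul _ _ (hf.pd_diff ht x), mul_add, Finset.mul_sum]
  congr 1
  exact Finset.sum_congr rfl fun j _ => by ring

theorem material_sum {ι : Type*} (s : Finset ι) (V : ℝ → Sp n → Sp n) {f : ι → ℝ → Sp n → ℝ}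
    (hf : ∀ i ∈ s, C1 τ (f i)) {t : ℝ} (ht : t ∈ Ioo 0 τ) (x : Sp n) :
    material V (fun t x => ∑ i ∈ s, f i t x) t x = ∑ i ∈ s, material V (f i) t x := by
  simp only [material]
  rw [deriv_fun_sum fun i hi => differentiableAt_time (hf i hi) ht x]
  simp only [pd_sum _ fun i hi => (hf i hi).pd_diff ht x, Finset.sum_add_distrib, Finset.mul_sum]
  rw [Finset.sum_comm]

theorem sum_pd_mul_velocity {f : ℝ → Sp n → ℝ} {V : ℝ → Sp n → Sp n} (hf : C1 τ f)
    (hV : ∀ j, C1 τ fun t x => V t x j) {t : ℝ} (ht : t ∈ Ioo 0 τ) (x : Sp n) :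
    ∑ j, pd j (fun y => f t y * V t y j) x
      = (∑ j, V t x j * pd j (f t) x) + f t x * divergence (V t) x := by
  simp only [pd_mul _ (hf.pd_diff ht x) ((hV _).pd_diff ht x), Finset.sum_add_distrib, divergence,
    Finset.mul_sum]
  congr 1
  exact Finset.sum_congr rfl fun j _ => by ring

theorem deriv_add_sum_pd_mul_velocity {f : ℝ → Sp n → ℝ} {V : ℝ → Sp n → Sp n} (hf : C1 τ f)
    (hV : ∀ j, C1 τ fun t x => V t x j) {t : ℝ} (ht : t ∈ Ioo 0 τ) (x : Sp n) :
    deriv (fun s => f s x) t + ∑ j, pd j (fun y => f t y * V t y j) x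
      = material V f t x + f t x * divergence (V t) x := by
  rw [sum_pd_mul_velocity hf hV ht x, material]
  ring

namespace IsClassicalSolution

theorem c1_V (h : IsClassicalSolution γ τ d u) (i : Fin n) : C1 τ fun t x => u.V t x i :=
  contDiffOn_coord h.smooth_V i

theorem material_density (h : IsClassicalSolution γ τ d u) {t : ℝ} (ht : t ∈ Ioo 0 τ) (x : Sp n) :
    material u.V u.ρ t x = -(u.ρ t x * divergence (u.V t) x) := by
  have := h.mass t ht x
  rw [deriv_add_sum_pd_mul_velocity h.smooth_ρ h.c1_V ht x] at this
  linarith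

theorem material_velocity (h : IsClassicalSolution γ τ d u) {t : ℝ} (ht : t ∈ Ioo 0 τ)
    (x : Sp n) (i : Fin n) :
    u.ρ t x * material u.V (fun t x => u.V t x i) t x = -pd i (u.p t) x := by
  have h1 := h.momentum t ht x i
  have hc : C1 τ fun t x => u.ρ t x * u.V t x i := h.smooth_ρ.mul (h.c1_V i)
  rw [deriv_add_sum_pd_mul_velocity hc h.c1_V ht x,
    material_mul u.V h.smooth_ρ (h.c1_V i) ht x, h.material_density ht x] at h1
  linarith

theorem material_pressure (h : IsClassicalSolution γ τ d u) (hγ : 1 < γ) {t : ℝ}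
    (ht : t ∈ Ioo 0 τ) (x : Sp n) :
    material u.V u.p t x = -(γ * u.p t x * divergence (u.V t) x) := by
  have hpow : ∀ r : ℝ, r ^ (γ - 1) * r = r ^ γ := by
    intro r
    rcases eq_or_ne r 0 with rfl | hr
    · rw [mul_zero, Real.zero_rpow (by linarith)]
    · rw [Real.rpow_sub_one hr, div_mul_cancel₀ _ hr]
  have hst := h.state t (Ioo_subset_Ico_self ht)
  have hS := h.entropy t ht x
  have hR := h.material_density ht x
  have hdt : deriv (fun s => u.p s x) t = u.p t x * deriv (fun s => u.S s x) t
      + Real.exp (u.S t x) * (γ * u.ρ t x ^ (γ - 1)) * deriv (fun s => u.ρ s x) t := by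
    have he : (fun s => u.p s x) =ᶠ[𝓝 t] fun s => Real.exp (u.S s x) * u.ρ s x ^ γ := by
      filter_upwards [Ioo_mem_nhds ht.1 ht.2] with s hs
      exact h.state s (Ioo_subset_Ico_self hs) x
    have h1 := (differentiableAt_time h.smooth_S ht x).hasDerivAt.exp
    have h2 := (differentiableAt_time h.smooth_ρ ht x).hasDerivAt.rpow_const (p := γ)
      (Or.inr hγ.le)
    rw [he.deriv_eq, (h1.fun_mul h2).deriv, hst x]
    ring
  have hdx : ∀ j, pd j (u.p t) x = u.p t x * pd j (u.S t) x
      + Real.exp (u.S t x) * (γ * u.ρ t x ^ (γ - 1)) * pd j (u.ρ t) x := by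
    intro j
    have he : u.p t = fun y => Real.exp (u.S t y) * u.ρ t y ^ γ := funext hst
    have h1 := (C1.pd_diff h.smooth_S ht x).hasFDerivAt.exp
    have h2 := (C1.pd_diff h.smooth_ρ ht x).hasFDerivAt.rpow_const (p := γ) (Or.inr hγ.le)
    have h3 := (h1.fun_mul h2).fderiv
    have h4 : pd j (u.p t) x = (fderiv ℝ (fun y => Real.exp (u.S t y) * u.ρ t y ^ γ) x)
        (EuclideanSpace.single j 1) := by rw [pd, he]
    rw [h4]
    rw [h3]
    rw [hst x]
    simp [pd]
    ring
  rw [material] at hR ⊢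
  rw [hdt]
  simp only [hdx]
  have hsum : ∑ j, u.V t x j * (u.p t x * pd j (u.S t) x
      + Real.exp (u.S t x) * (γ * u.ρ t x ^ (γ - 1)) * pd j (u.ρ t) x)
      = u.p t x * ∑ j, u.V t x j * pd j (u.S t) x
        + Real.exp (u.S t x) * (γ * u.ρ t x ^ (γ - 1)) * ∑ j, u.V t x j * pd j (u.ρ t) x := by
    rw [Finset.mul_sum, Finset.mul_sum, ← Finset.sum_add_distrib]
    exact Finset.sum_congr rfl fun j _ => by ring
  rw [hsum]
  have hp : u.p t x = Real.exp (u.S t x) * (u.ρ t x ^ (γ - 1) * u.ρ t x) := by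
    rw [hst x, hpow]
  linear_combination u.p t x * hS + Real.exp (u.S t x) * (γ * u.ρ t x ^ (γ - 1)) * hR
    + γ * divergence (u.V t) x * hp

theorem c1_normSq (h : IsClassicalSolution γ τ d u) : C1 τ fun t x => ‖u.V t x‖ ^ 2 :=
  h.smooth_V.norm_sq ℝ

theorem material_normSq (h : IsClassicalSolution γ τ d u) {t : ℝ} (ht : t ∈ Ioo 0 τ) (x : Sp n) :
    u.ρ t x * material u.V (fun t x => ‖u.V t x‖ ^ 2) t x
      = -2 * ∑ j, u.V t x j * pd j (u.p t) x := by
  have he : (fun (t : ℝ) (x : Sp n) => ‖u.V t x‖ ^ 2)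
      = fun t x => ∑ i, u.V t x i * u.V t x i := by
    funext t x
    rw [EuclideanSpace.real_norm_sq_eq]
    exact Finset.sum_congr rfl fun i _ => sq _
  rw [he, material_sum Finset.univ u.V (f := fun i t x => u.V t x i * u.V t x i)
    (fun i _ => (h.c1_V i).mul (h.c1_V i)) ht x, Finset.mul_sum, Finset.mul_sum]
  refine Finset.sum_congr rfl fun i _ => ?_
  rw [material_mul u.V (h.c1_V i) (h.c1_V i) ht x]
  linear_combination (2 * u.V t x i) * h.material_velocity ht x i

theorem mono (h : IsClassicalSolution γ τ d u) {σ : ℝ} (hσ : σ ≤ τ) :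
    IsClassicalSolution γ σ d u where
  smooth_ρ := C1.mono h.smooth_ρ hσ
  smooth_V := h.smooth_V.mono (prod_mono (Ico_subset_Ico_right hσ) subset_rfl)
  smooth_S := C1.mono h.smooth_S hσ
  smooth_p := C1.mono h.smooth_p hσ
  momentum t ht := h.momentum t (Ioo_subset_Ioo_right hσ ht)
  mass t ht := h.mass t (Ioo_subset_Ioo_right hσ ht)
  entropy t ht := h.entropy t (Ioo_subset_Ioo_right hσ ht)
  state t ht := h.state t (Ico_subset_Ico_right hσ ht)
  init_ρ := h.init_ρ
  init_V := h.init_V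
  init_p := h.init_p

theorem continuousOn_divergence (h : IsClassicalSolution γ τ d u) :
    ContinuousOn (fun z : ℝ × Sp n => divergence (u.V z.1) z.2) (Ico 0 τ ×ˢ univ) :=
  continuousOn_finsetSum _ fun j _ =>
    continuousOn_pd (f := fun t x => u.V t x j) (h.c1_V j) j

theorem c1_kinetic (h : IsClassicalSolution γ τ d u) : C1 τ fun t x => u.ρ t x * ‖u.V t x‖ ^ 2 :=
  h.smooth_ρ.mul h.c1_normSq

theorem material_kinetic (h : IsClassicalSolution γ τ d u) {t : ℝ} (ht : t ∈ Ioo 0 τ) (x : Sp n) :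
    material u.V (fun t x => u.ρ t x * ‖u.V t x‖ ^ 2) t x
      = -2 * (∑ j, u.V t x j * pd j (u.p t) x)
        - u.ρ t x * ‖u.V t x‖ ^ 2 * divergence (u.V t) x := by
  rw [material_mul u.V h.smooth_ρ h.c1_normSq ht x, h.material_density ht x,
    h.material_normSq ht x]
  ring

end IsClassicalSolution

end Pointwise

section FiniteSpeed

variable {n : ℕ} {γ τ : ℝ} {d : Data n} {u : Flow n}

theorem hasDerivAt_max_zero_sq (y : ℝ) :
    HasDerivAt (fun y : ℝ => (max 0 y) ^ 2) (2 * max 0 y) y := by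
  rcases lt_trichotomy y 0 with hy | rfl | hy
  · have : (fun y : ℝ => (max 0 y) ^ 2) =ᶠ[𝓝 y] fun _ => 0 := by
      filter_upwards [Iio_mem_nhds hy] with z hz
      simp [max_eq_left (mem_Iio.1 hz).le]
    rw [max_eq_left hy.le, mul_zero]
    exact (hasDerivAt_const y (0 : ℝ)).congr_of_eventuallyEq this
  · rw [max_self, mul_zero, hasDerivAt_iff_isLittleO_nhds_zero]
    have h1 : (fun h : ℝ => h ^ 2) =o[𝓝 0] fun h => h := by
      simpa using Asymptotics.isLittleO_pow_id (𝕜 := ℝ) (n := 2) (by norm_num)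
    refine (Asymptotics.IsBigO.of_bound 1 (Eventually.of_forall fun h => ?_)).trans_isLittleO h1
    simp only [zero_add, max_self, smul_zero, sub_zero, ne_eq, OfNat.ofNat_ne_zero,
      not_false_eq_true, zero_pow, norm_pow, Real.norm_eq_abs, one_mul]
    refine pow_le_pow_left₀ (abs_nonneg _) ?_ 2
    rcases le_total 0 h with hh | hh
    · simp [max_eq_right hh]
    · simp [max_eq_left hh]
  · have : (fun y : ℝ => (max 0 y) ^ 2) =ᶠ[𝓝 y] fun y => y ^ 2 := by
      filter_upwards [Ioi_mem_nhds hy] with z hz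
      simp [max_eq_right (mem_Ioi.1 hz).le]
    rw [max_eq_right hy.le]
    simpa using (hasDerivAt_pow 2 y).congr_of_eventuallyEq this

theorem contDiff_max_zero_sq : ContDiff ℝ 1 (fun y : ℝ => (max 0 y) ^ 2) := by
  rw [contDiff_one_iff_deriv]
  refine ⟨fun y => (hasDerivAt_max_zero_sq y).differentiableAt, ?_⟩
  rw [show deriv (fun y : ℝ => (max 0 y) ^ 2) = fun y => 2 * max 0 y from
    funext fun y => (hasDerivAt_max_zero_sq y).deriv]
  fun_prop

/-- A nonnegative weight supported in the backward cone `‖x - x₀‖ ≤ r - s t`. -/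
noncomputable def coneWeight {n : ℕ} (x₀ : Sp n) (r s t : ℝ) (x : Sp n) : ℝ :=
  (max 0 ((r - s * t) ^ 2 - ‖x - x₀‖ ^ 2)) ^ 2

theorem contDiff_coneWeight (x₀ : Sp n) (r s : ℝ) :
    ContDiff ℝ 1 (fun z : ℝ × Sp n => coneWeight x₀ r s z.1 z.2) :=
  contDiff_max_zero_sq.comp (f := fun z : ℝ × Sp n => (r - s * z.1) ^ 2 - ‖z.2 - x₀‖ ^ 2)
    (((contDiff_const.sub (contDiff_const.mul contDiff_fst)).pow 2).sub
      ((contDiff_snd.sub contDiff_const).norm_sq ℝ))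

theorem c1_coneWeight (τ : ℝ) (x₀ : Sp n) (r s : ℝ) : C1 τ (coneWeight x₀ r s) :=
  (contDiff_coneWeight x₀ r s).contDiffOn

theorem coneWeight_nonneg (x₀ : Sp n) (r s t : ℝ) (x : Sp n) : 0 ≤ coneWeight x₀ r s t x :=
  sq_nonneg _

theorem coneWeight_eq_zero {x₀ : Sp n} {r s t : ℝ} {x : Sp n} (h : 0 ≤ r - s * t)
    (hx : r - s * t ≤ ‖x - x₀‖) : coneWeight x₀ r s t x = 0 := by
  have : (r - s * t) ^ 2 ≤ ‖x - x₀‖ ^ 2 := by gcongr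
  rw [coneWeight, max_eq_left (by linarith)]
  norm_num

theorem coneWeight_pos {x₀ : Sp n} {r s t : ℝ} {x : Sp n} (hx : ‖x - x₀‖ < r - s * t) :
    0 < coneWeight x₀ r s t x := by
  have : ‖x - x₀‖ ^ 2 < (r - s * t) ^ 2 := by gcongr
  exact pow_pos (lt_max_of_lt_right (by linarith)) 2

theorem deriv_coneWeight (x₀ : Sp n) (r s t : ℝ) (x : Sp n) :
    deriv (fun t => coneWeight x₀ r s t x) t
      = -4 * max 0 ((r - s * t) ^ 2 - ‖x - x₀‖ ^ 2) * (s * (r - s * t)) := by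
  have h1 : HasDerivAt (fun t : ℝ => (r - s * t) ^ 2 - ‖x - x₀‖ ^ 2)
      (2 * (r - s * t) * -s) t := by
    have := ((((hasDerivAt_id t).const_mul s).const_sub r).pow 2).sub_const (‖x - x₀‖ ^ 2)
    simpa using this
  have h2 := (hasDerivAt_max_zero_sq _).comp t h1
  have h3 : deriv (fun t => coneWeight x₀ r s t x) t = _ := h2.deriv
  rw [h3]
  ring

theorem pd_coneWeight (x₀ : Sp n) (r s t : ℝ) (x : Sp n) (j : Fin n) :
    pd j (coneWeight x₀ r s t) x
      = -4 * max 0 ((r - s * t) ^ 2 - ‖x - x₀‖ ^ 2) * (x j - x₀ j) := by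
  have hd : DifferentiableAt ℝ (fun y : Sp n => ‖y - x₀‖ ^ 2) x :=
    (differentiableAt_id.sub_const x₀).norm_sq ℝ
  have h1 := hd.hasFDerivAt.const_sub ((r - s * t) ^ 2)
  have h2 := (hasDerivAt_max_zero_sq _).comp_hasFDerivAt x h1
  have h3 : fderiv ℝ (coneWeight x₀ r s t) x = _ := h2.fderiv
  have h4 := pd_norm_sq j x₀ x
  rw [pd] at h4 ⊢
  rw [h3]
  simp only [smul_apply, neg_apply, smul_eq_mul, h4]
  ring

/-- The quadratic energy density of the deviation from a state at rest with pressure `pbar`. -/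
noncomputable def devEnergy {n : ℕ} (γ pbar : ℝ) (u : Flow n) (t : ℝ) (x : Sp n) : ℝ :=
  1 / 2 * (u.ρ t x * ‖u.V t x‖ ^ 2)
    + 1 / (2 * (γ * pbar)) * ((u.p t x - pbar) * (u.p t x - pbar))

namespace IsClassicalSolution

theorem c1_devPressure (h : IsClassicalSolution γ τ d u) (pbar : ℝ) :
    C1 τ fun t x => u.p t x - pbar :=
  h.smooth_p.sub contDiffOn_const

theorem c1_devEnergy (h : IsClassicalSolution γ τ d u) (pbar : ℝ) :
    C1 τ (devEnergy γ pbar u) :=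
  (contDiffOn_const.mul h.c1_kinetic).add
    (contDiffOn_const.mul ((h.c1_devPressure pbar).mul (h.c1_devPressure pbar)))

theorem material_devEnergy (h : IsClassicalSolution γ τ d u) (hγ : 1 < γ) (pbar : ℝ) {t : ℝ}
    (ht : t ∈ Ioo 0 τ) (x : Sp n) :
    material u.V (devEnergy γ pbar u) t x
      = -(∑ j, u.V t x j * pd j (u.p t) x)
        - 1 / 2 * (u.ρ t x * ‖u.V t x‖ ^ 2) * divergence (u.V t) x
        - 1 / (2 * (γ * pbar)) * (2 * (u.p t x - pbar) * (γ * u.p t x * divergence (u.V t) x)) := by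
  have hP := h.c1_devPressure pbar
  have e : devEnergy γ pbar u = fun t x => 1 / 2 * (u.ρ t x * ‖u.V t x‖ ^ 2)
    + 1 / (2 * (γ * pbar)) * ((u.p t x - pbar) * (u.p t x - pbar)) := rfl
  rw [e, material_add (τ := τ) u.V (f := fun t x => 1 / 2 * (u.ρ t x * ‖u.V t x‖ ^ 2))
      (g := fun t x => 1 / (2 * (γ * pbar)) * ((u.p t x - pbar) * (u.p t x - pbar)))
      (contDiffOn_const.mul h.c1_kinetic) (contDiffOn_const.mul (hP.mul hP)) ht x,
    material_const_mul u.V h.c1_kinetic _ ht x,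
    material_const_mul (τ := τ) u.V (f := fun t x => (u.p t x - pbar) * (u.p t x - pbar))
      (hP.mul hP) _ ht x, material_mul u.V hP hP ht x,
    material_sub_const, h.material_pressure hγ ht x, h.material_kinetic ht x]
  ring

/-- The balance law of the weighted quadratic energy. -/
theorem weighted_devEnergy_balance (h : IsClassicalSolution γ τ d u) (hγ : 1 < γ) {pbar : ℝ}
    (hp : 0 < pbar) {w : ℝ → Sp n → ℝ} (hw : C1 τ w) {t : ℝ} (ht : t ∈ Ioo 0 τ) (x : Sp n) :
    deriv (fun s => w s x * devEnergy γ pbar u s x) t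
      + ∑ j, pd j (fun y => (w t y * devEnergy γ pbar u t y + w t y * (u.p t y - pbar))
          * u.V t y j) x
      = devEnergy γ pbar u t x * deriv (fun s => w s x) t
        + (devEnergy γ pbar u t x + (u.p t x - pbar)) * (∑ j, u.V t x j * pd j (w t) x)
        + w t x * ((1 / 2 - γ) / (γ * pbar) * (u.p t x - pbar) ^ 2 * divergence (u.V t) x) := by
  have hP := h.c1_devPressure pbar
  have hE := h.c1_devEnergy pbar
  have hwE : C1 τ fun t x => w t x * devEnergy γ pbar u t x := hw.mul hE
  have hwP : C1 τ fun t x => w t x * (u.p t x - pbar) := hw.mul hP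
  rw [sum_pd_mul_velocity (f := fun t y => w t y * devEnergy γ pbar u t y
    + w t y * (u.p t y - pbar)) (hwE.add hwP) h.c1_V ht x]
  have hE' := h.material_devEnergy hγ pbar ht x
  have hm := material_mul u.V hw hE ht x
  have e1 : ∑ j, u.V t x j * pd j (fun y => w t y * devEnergy γ pbar u t y
        + w t y * (u.p t y - pbar)) x
      = (∑ j, u.V t x j * pd j (fun y => w t y * devEnergy γ pbar u t y) x)
        + ((∑ j, u.V t x j * pd j (w t) x) * (u.p t x - pbar)
        + w t x * ∑ j, u.V t x j * pd j (u.p t) x) := by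
    simp only [pd_add _ (hwE.pd_diff ht x) (hwP.pd_diff ht x),
      pd_mul _ (hw.pd_diff ht x) (hP.pd_diff ht x), pd_sub_const]
    rw [Finset.sum_mul, Finset.mul_sum, ← Finset.sum_add_distrib, ← Finset.sum_add_distrib]
    exact Finset.sum_congr rfl fun j _ => by ring
  rw [e1]
  rw [hE'] at hm
  simp only [material] at hm
  have hγp : γ * pbar ≠ 0 := by positivity
  have hkey : devEnergy γ pbar u t x = 1 / 2 * (u.ρ t x * ‖u.V t x‖ ^ 2)
    + 1 / (2 * (γ * pbar)) * ((u.p t x - pbar) * (u.p t x - pbar)) := rfl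
  have hq : - (1 / (2 * (γ * pbar)) * (2 * (u.p t x - pbar) * (γ * u.p t x)))
      + 1 / (2 * (γ * pbar)) * ((u.p t x - pbar) * (u.p t x - pbar)) + (u.p t x - pbar)
      = (1 / 2 - γ) / (γ * pbar) * (u.p t x - pbar) ^ 2 := by
    field_simp
    ring
  linear_combination hm + w t x * divergence (u.V t) x * hkey
    + w t x * divergence (u.V t) x * hq

end IsClassicalSolution

end FiniteSpeed

section Cone

variable {n : ℕ} {γ τ : ℝ} {d : Data n} {u : Flow n}

theorem sum_mul_pd_coneWeight (v x₀ x : Sp n) (r s t : ℝ) :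
    ∑ j, v j * pd j (coneWeight x₀ r s t) x
      = -4 * max 0 ((r - s * t) ^ 2 - ‖x - x₀‖ ^ 2) * inner ℝ v (x - x₀) := by
  simp only [pd_coneWeight, PiLp.inner_apply, Finset.mul_sum]
  refine Finset.sum_congr rfl fun j _ => ?_
  simp
  ring

/-- The flux of the quadratic energy through a surface moving with speed `s` is dominated by
the transport of the energy. -/
theorem abs_flux_le {γ pbar c s ρ v P e : ℝ} (hγp : 0 < γ * pbar) (hc : 0 < c)
    (hvs : v ≤ s - c) (hρ : γ * pbar ≤ c ^ 2 * ρ)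
    (he : e = 1 / 2 * (ρ * v ^ 2) + 1 / (2 * (γ * pbar)) * (P * P)) :
    (e + |P|) * v ≤ s * e := by
  have hρ0 : 0 < ρ := by
    by_contra hneg
    nlinarith [sq_nonneg c, not_lt.1 hneg]
  have he0 : 0 ≤ e := by
    rw [he]
    have := mul_self_nonneg P
    positivity
  have h1 : |P| * v ≤ c * e := by
    have h2 : e = (γ * pbar * (ρ * v ^ 2) + |P| ^ 2) / (2 * (γ * pbar)) := by
      have h3 := left_ne_zero_of_mul hγp.ne'
      have h4 := right_ne_zero_of_mul hγp.ne'
      rw [he, sq_abs]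
      field_simp
    have h4 : c * e = c * (γ * pbar * (ρ * v ^ 2) + |P| ^ 2) / (2 * (γ * pbar)) := by
      rw [h2]
      ring
    rw [h4, le_div_iff₀ (by positivity)]
    have h5 : (γ * pbar) ^ 2 * v ^ 2 ≤ c ^ 2 * (γ * pbar * (ρ * v ^ 2)) := by
      have := mul_le_mul_of_nonneg_left hρ (by positivity : 0 ≤ γ * pbar * v ^ 2)
      nlinarith
    have h6 : 0 ≤ (c * |P| - γ * pbar * v) ^ 2 := sq_nonneg _
    have h7 : c * (|P| * v * (2 * (γ * pbar))) ≤
        c * (c * (γ * pbar * (ρ * v ^ 2) + |P| ^ 2)) := by nlinarith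
    exact le_of_mul_le_mul_left h7 hc
  nlinarith

namespace IsClassicalSolution

/-- Vanishing of the deviation from the state at rest inside a backward cone of slope `s`, as long
as the characteristic speeds inside the cone do not exceed `s`. -/
theorem eq_rest_of_subsonic_cone (h : IsClassicalSolution γ τ d u) (hγ : 1 < γ) {pbar c s r : ℝ}
    (hp : 0 < pbar) (hc : 0 < c) (hs : 0 ≤ s) (x₀ : Sp n) (hr : s * τ ≤ r)
    (hgood : ∀ t ∈ Ico 0 τ, ∀ x, ‖x - x₀‖ ≤ r - s * t →
      γ * pbar ≤ c ^ 2 * u.ρ t x ∧ ‖u.V t x‖ ≤ s - c)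
    (hinit : ∀ x, ‖x - x₀‖ ≤ r → u.V 0 x = 0 ∧ u.p 0 x = pbar)
    {t : ℝ} (ht : t ∈ Ico 0 τ) {x : Sp n} (hx : ‖x - x₀‖ < r - s * t) :
    u.V t x = 0 ∧ u.p t x = pbar := by
  rcases ht.1.eq_or_lt with rfl | ht0
  · exact hinit x (by linarith)
  have hγp : 0 < γ * pbar := by positivity
  have hst : ∀ t ∈ Ico 0 τ, 0 ≤ r - s * t := fun t ht => by nlinarith [ht.2]
  set W : ℝ → Sp n → ℝ := coneWeight x₀ r s with hW
  set e : ℝ → Sp n → ℝ := devEnergy γ pbar u with he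
  set K : Set (Sp n) := Metric.closedBall x₀ r with hK
  have hKc : IsCompact K := isCompact_closedBall x₀ r
  have hW0 : ∀ t ∈ Ico 0 τ, ∀ x, r - s * t ≤ ‖x - x₀‖ → W t x = 0 := fun t ht x hx =>
    coneWeight_eq_zero (hst t ht) hx
  have hWK : ∀ t ∈ Ico 0 τ, ∀ x, x ∉ K → W t x = 0 := fun t ht x hx => by
    refine hW0 t ht x ?_
    rw [hK, mem_closedBall_iff_norm, not_le] at hx
    nlinarith [ht.1]
  have hWc : C1 τ W := c1_coneWeight τ x₀ r s
  have hec : C1 τ e := h.c1_devEnergy pbar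
  have hρ0 : ∀ t ∈ Ico 0 τ, ∀ x, ‖x - x₀‖ ≤ r - s * t → 0 < u.ρ t x := fun t ht x hx => by
    have := (hgood t ht x hx).1
    by_contra hneg
    nlinarith [sq_nonneg c, not_lt.1 hneg]
  have he0 : ∀ t ∈ Ico 0 τ, ∀ x, ‖x - x₀‖ ≤ r - s * t → 0 ≤ e t x := fun t ht x hx => by
    have h1 := hρ0 t ht x hx
    have := mul_self_nonneg (u.p t x - pbar)
    simp only [he, devEnergy]
    positivity
  have hWe0 : ∀ t ∈ Ico 0 τ, ∀ x, 0 ≤ W t x * e t x := fun t ht x => by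
    rcases le_total (‖x - x₀‖) (r - s * t) with hx | hx
    · exact mul_nonneg (coneWeight_nonneg _ _ _ _ _) (he0 t ht x hx)
    · rw [hW0 t ht x hx, zero_mul]
  have hsub : Icc 0 t ⊆ Ico 0 τ := fun a ha => ⟨ha.1, ha.2.trans_lt ht.2⟩
  obtain ⟨D, hD⟩ := (isCompact_Icc.prod hKc).exists_bound_of_continuousOn
    (h.continuousOn_divergence.mono (prod_mono hsub (subset_univ K)))
  set M : ℝ := (2 * γ - 1) * D with hM
  set E : ℝ → ℝ := fun t => ∫ x, W t x * e t x with hE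
  have hWec : C1 τ fun t x => W t x * e t x := hWc.mul hec
  have hEcont : ContinuousOn E (Ico 0 τ) :=
    continuousOn_integral_of_compact_support hKc hWec.continuousOn
      (fun t x ht hx => by rw [hWK t ht x hx, zero_mul])
  have hWect : ∀ t ∈ Ico 0 τ, Continuous fun x => W t x * e t x := fun t ht =>
    (contDiff_slice (f := fun t x => W t x * e t x) hWec ht).continuous
  have hWeI : ∀ t ∈ Ico 0 τ, Integrable fun x => W t x * e t x := fun t ht =>
    integrable_of_eq_zero_off_compact (hWect t ht) hKc
      (fun x hx => by rw [hWK t ht x hx, zero_mul])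
  have hder : ∀ t' ∈ Ioo 0 t, ∃ E', HasDerivAt E E' t' ∧ E' ≤ M * E t' := by
    intro a ha
    have ha' : a ∈ Ioo 0 τ := ⟨ha.1, ha.2.trans ht.2⟩
    have ha'' : a ∈ Ico 0 τ := Ioo_subset_Ico_self ha'
    obtain ⟨hI, hd⟩ := hasDerivAt_integral_of_balance hKc
      (a := fun t x => W t x * e t x) hWec
      (b := fun j t y => (W t y * e t y + W t y * (u.p t y - pbar)) * u.V t y j)
      (fun j => (hWec.add (hWc.mul (h.c1_devPressure pbar))).mul (h.c1_V j))
      (fun t ht x hx => by rw [hWK t (Ioo_subset_Ico_self ht) x hx, zero_mul])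
      (fun j t ht x hx => by simp [hWK t (Ioo_subset_Ico_self ht) x hx]) ha'
      (h.weighted_devEnergy_balance hγ hp hWc ha')
    refine ⟨_, hd, ?_⟩
    rw [hE, ← integral_const_mul]
    refine integral_mono hI ((hWeI a ha'').const_mul M) fun x => ?_
    simp only
    rcases le_total (‖x - x₀‖) (r - s * a) with hx | hx
    · have hxK : x ∈ K := by
        rw [hK, mem_closedBall_iff_norm]
        nlinarith [ha.1]
      have hg := hgood a ha'' x hx
      have hfl := abs_flux_le (P := u.p a x - pbar) (e := e a x) hγp hc hg.2 hg.1 rfl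
      have hDx := hD (a, x) ⟨⟨ha.1.le, ha.2.le⟩, hxK⟩
      simp only [Real.norm_eq_abs] at hDx
      have hw : 0 ≤ W a x := coneWeight_nonneg _ _ _ _ _
      rw [sum_mul_pd_coneWeight, deriv_coneWeight]
      set m : ℝ := max 0 ((r - s * a) ^ 2 - ‖x - x₀‖ ^ 2)
      have hm : 0 ≤ m := le_max_left _ _
      have hin : |inner ℝ (u.V a x) (x - x₀)| ≤ ‖u.V a x‖ * (r - s * a) :=
        (abs_real_inner_le_norm _ _).trans (by gcongr)
      have hee : 0 ≤ e a x := he0 a ha'' x hx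
      have h1 : -((e a x + (u.p a x - pbar)) * inner ℝ (u.V a x) (x - x₀))
          ≤ s * e a x * (r - s * a) := by
        calc -((e a x + (u.p a x - pbar)) * inner ℝ (u.V a x) (x - x₀))
            ≤ |(e a x + (u.p a x - pbar)) * inner ℝ (u.V a x) (x - x₀)| := neg_le_abs _
          _ = |e a x + (u.p a x - pbar)| * |inner ℝ (u.V a x) (x - x₀)| := abs_mul _ _
          _ ≤ (e a x + |u.p a x - pbar|) * (‖u.V a x‖ * (r - s * a)) := by
              refine mul_le_mul ?_ hin (abs_nonneg _) (by positivity)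
              exact (abs_add_le _ _).trans (by rw [abs_of_nonneg hee])
          _ = (e a x + |u.p a x - pbar|) * ‖u.V a x‖ * (r - s * a) := by ring
          _ ≤ s * e a x * (r - s * a) :=
              mul_le_mul_of_nonneg_right hfl (hst a ha'')
      have h2 : (1 / 2 - γ) / (γ * pbar) * (u.p a x - pbar) ^ 2 * divergence (u.V a) x
          ≤ M * e a x := by
        have h3 : 1 / (2 * (γ * pbar)) * (u.p a x - pbar) ^ 2 ≤ e a x := by
          have := hρ0 a ha'' x hx
          have h4 : 0 ≤ 1 / 2 * (u.ρ a x * ‖u.V a x‖ ^ 2) := by positivity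
          simp only [he, devEnergy]
          linarith [sq (u.p a x - pbar)]
        have h5 : 0 ≤ 1 / (2 * (γ * pbar)) * (u.p a x - pbar) ^ 2 := by positivity
        have h6 : (1 / 2 - γ) / (γ * pbar) * (u.p a x - pbar) ^ 2 * divergence (u.V a) x
            = (2 * γ - 1) * ((1 / (2 * (γ * pbar)) * (u.p a x - pbar) ^ 2)
              * -divergence (u.V a) x) := by
          field_simp
          ring
        rw [h6, hM, mul_assoc (2 * γ - 1) D]
        refine mul_le_mul_of_nonneg_left ?_ (by linarith)
        rw [mul_comm D]
        exact (mul_le_mul_of_nonneg_left ((neg_le_abs _).trans hDx) h5).trans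
          (mul_le_mul_of_nonneg_right h3 ((abs_nonneg _).trans hDx))
      have h7 := mul_le_mul_of_nonneg_left h2 hw
      have h8 := mul_le_mul_of_nonneg_left h1 (by positivity : 0 ≤ 4 * m)
      linarith
    · rw [sum_mul_pd_coneWeight, deriv_coneWeight, hW0 a ha'' x hx]
      have : (r - s * a) ^ 2 ≤ ‖x - x₀‖ ^ 2 := by
        have := hst a ha''
        gcongr
      rw [max_eq_left (by linarith)]
      simp
  have hanti : AntitoneOn (fun t => Real.exp (-(M * t)) * E t) (Icc 0 t) := by
    have hexp : ∀ a : ℝ, HasDerivAt (fun t => Real.exp (-(M * t)))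
        (Real.exp (-(M * a)) * -(M * 1)) a := fun a =>
      (((hasDerivAt_id a).const_mul M).neg).exp
    refine antitoneOn_of_deriv_nonpos (convex_Icc 0 t)
      ((Continuous.continuousOn (by fun_prop)).mul (hEcont.mono hsub)) ?_ ?_
    · rw [interior_Icc]
      intro a ha
      obtain ⟨E', hE', -⟩ := hder a ha
      exact ((hexp a).mul hE').differentiableAt.differentiableWithinAt
    · rw [interior_Icc]
      intro a ha
      obtain ⟨E', hE', hle⟩ := hder a ha
      rw [((hexp a).fun_mul hE').deriv]
      nlinarith [Real.exp_pos (-(M * a))]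
  have hE0 : E 0 = 0 := by
    refine integral_eq_zero_of_ae (Eventually.of_forall fun x => ?_)
    have h00 : (0 : ℝ) ∈ Ico 0 τ := ⟨le_rfl, ht0.trans ht.2⟩
    rcases le_total (‖x - x₀‖) r with hx | hx
    · simp [he, devEnergy, hinit x hx]
    · simp [hW0 0 h00 x (by simpa using hx)]
  have hEt : E t ≤ 0 := by
    have := hanti (left_mem_Icc.2 ht0.le) (right_mem_Icc.2 ht0.le) ht0.le
    simp only [hE0, mul_zero] at this
    exact nonpos_of_mul_nonpos_right this (Real.exp_pos _)
  have hEt0 : E t = 0 := le_antisymm hEt (integral_nonneg (hWe0 t ht))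
  have hae := (integral_eq_zero_iff_of_nonneg (hWe0 t ht) (hWeI t ht)).1 hEt0
  have hzero := ((hWect t ht).ae_eq_iff_eq volume continuous_zero).1 hae
  have hxz : W t x * e t x = 0 := congrFun hzero x
  have hex : e t x = 0 := (mul_eq_zero.1 hxz).resolve_left (coneWeight_pos hx).ne'
  have hρx := hρ0 t ht x hx.le
  simp only [he, devEnergy] at hex
  have a1 : 0 ≤ 1 / 2 * (u.ρ t x * ‖u.V t x‖ ^ 2) := by positivity
  have a2 : 0 ≤ 1 / (2 * (γ * pbar)) * ((u.p t x - pbar) * (u.p t x - pbar)) :=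
    mul_nonneg (by positivity) (mul_self_nonneg _)
  constructor
  · have : 1 / 2 * (u.ρ t x * ‖u.V t x‖ ^ 2) = 0 := by linarith
    simpa [hρx.ne'] using this
  · have : 1 / (2 * (γ * pbar)) * ((u.p t x - pbar) * (u.p t x - pbar)) = 0 := by linarith
    have hne : 1 / (2 * (γ * pbar)) ≠ 0 := by positivity
    have := mul_self_eq_zero.1 ((mul_eq_zero.1 this).resolve_left hne)
    linarith

/-- Where the fluid stays at rest, the density does not change. -/
theorem density_eq_of_rest (h : IsClassicalSolution γ τ d u) {t : ℝ} (ht : t ∈ Ico 0 τ)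
    {x : Sp n} (hrest : ∀ s ∈ Ioo 0 t, ∀ᶠ y in 𝓝 x, u.V s y = 0) : u.ρ t x = u.ρ 0 x := by
  rcases ht.1.eq_or_lt with rfl | ht0
  · rfl
  have hcont : ContinuousOn (fun s => u.ρ s x) (Icc 0 t) :=
    h.smooth_ρ.continuousOn.comp (f := fun s : ℝ => (s, x)) (by fun_prop)
      (fun s hs => ⟨⟨hs.1, hs.2.trans_lt ht.2⟩, mem_univ x⟩)
  have hd : ∀ s ∈ Ioo 0 t, HasDerivAt (fun s => u.ρ s x) 0 s := fun s hs => by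
    have hs' : s ∈ Ioo 0 τ := ⟨hs.1, hs.2.trans ht.2⟩
    have h1 := h.mass s hs' x
    have h2 : ∀ j, pd j (fun y => u.ρ s y * u.V s y j) x = 0 := fun j => by
      have : (fun y => u.ρ s y * u.V s y j) =ᶠ[𝓝 x] fun _ => 0 := by
        filter_upwards [hrest s hs] with y hy
        simp [hy]
      simp [pd, this.fderiv_eq]
    simp only [h2, Finset.sum_const_zero, add_zero] at h1
    have := (differentiableAt_time h.smooth_ρ hs' x).hasDerivAt
    rwa [h1] at this
  obtain ⟨c, -, hc⟩ := exists_hasDerivAt_eq_slope (fun s => u.ρ s x) (fun _ => 0) ht0 hcont hd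
  have h3 := (eq_div_iff (by linarith : t - 0 ≠ 0)).1 hc
  linarith

end IsClassicalSolution

end Cone

section Propagation

variable {n : ℕ} {γ τ : ℝ} {d : Data n} {u : Flow n}

theorem eq_of_continuousOn_Icc {E : Type*} [TopologicalSpace E] [T2Space E] {g : ℝ → E} {t : ℝ}
    {c : E} (ht : 0 < t) (hg : ContinuousOn g (Icc 0 t)) (h : ∀ s ∈ Ioo 0 t, g s = c) :
    g t = c := by
  have h1 : Tendsto g (𝓝[Ioo 0 t] t) (𝓝 (g t)) :=
    (hg t (right_mem_Icc.2 ht.le)).mono Ioo_subset_Icc_self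
  have h2 : Tendsto g (𝓝[Ioo 0 t] t) (𝓝 c) :=
    tendsto_const_nhds.congr' (by
      filter_upwards [self_mem_nhdsWithin] with s hs
      exact (h s hs).symm)
  have : (𝓝[Ioo 0 t] t).NeBot := by
    rw [← mem_closure_iff_nhdsWithin_neBot, closure_Ioo ht.ne]
    exact right_mem_Icc.2 ht.le
  exact tendsto_nhds_unique h1 h2

theorem continuousOn_time {E : Type*} [TopologicalSpace E] {f : ℝ → Sp n → E}
    (hf : ContinuousOn (fun z : ℝ × Sp n => f z.1 z.2) (Ico 0 τ ×ˢ univ)) (x : Sp n) :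
    ContinuousOn (fun s => f s x) (Ico 0 τ) :=
  hf.comp (f := fun s : ℝ => (s, x)) (by fun_prop) fun _ hs => ⟨hs, mem_univ x⟩

namespace IsClassicalSolution

theorem eq_const_of_subsonic_cone (h : IsClassicalSolution γ τ d u) (hγ : 1 < γ)
    {ρbar pbar c s r : ℝ} (hp : 0 < pbar) (hc : 0 < c) (hs : 0 ≤ s) (x₀ : Sp n)
    (hr : s * τ ≤ r)
    (hgood : ∀ t ∈ Ico 0 τ, ∀ x, ‖x - x₀‖ ≤ r - s * t →
      γ * pbar ≤ c ^ 2 * u.ρ t x ∧ ‖u.V t x‖ ≤ s - c)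
    (hinit : ∀ x, ‖x - x₀‖ ≤ r → u.ρ 0 x = ρbar ∧ u.V 0 x = 0 ∧ u.p 0 x = pbar)
    {t : ℝ} (ht : t ∈ Ico 0 τ) {x : Sp n} (hx : ‖x - x₀‖ < r - s * t) :
    u.ρ t x = ρbar ∧ u.V t x = 0 ∧ u.p t x = pbar := by
  have hrest : ∀ t ∈ Ico 0 τ, ∀ x, ‖x - x₀‖ < r - s * t → u.V t x = 0 ∧ u.p t x = pbar :=
    fun t ht x hx => h.eq_rest_of_subsonic_cone hγ hp hc hs x₀ hr hgood
      (fun x hx => (hinit x hx).2) ht hx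
  refine ⟨?_, hrest t ht x hx⟩
  rw [h.density_eq_of_rest ht (x := x), (hinit x ?_).1]
  · nlinarith [ht.1]
  · intro a ha
    have hopen : IsOpen {y : Sp n | ‖y - x₀‖ < r - s * a} :=
      isOpen_lt (by fun_prop) continuous_const
    filter_upwards [hopen.mem_nhds (show ‖x - x₀‖ < r - s * a by nlinarith [ha.2])] with y hy
    exact (hrest a ⟨ha.1.le, ha.2.trans ht.2⟩ y hy).1

/-- A backward cone of slope greater than the sound speed whose base lies in the region of constant
data contains only the constant state. -/
theorem eq_const_of_cone (h : IsClassicalSolution γ τ d u) (hγ : 1 < γ)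
    {ρbar pbar c s r : ℝ} (hp : 0 < pbar) (hc : 0 < c) (hcs : c < s)
    (hcρ : γ * pbar < c ^ 2 * ρbar) (x₀ : Sp n) (hr : s * τ ≤ r)
    (hinit : ∀ x, ‖x - x₀‖ ≤ r → u.ρ 0 x = ρbar ∧ u.V 0 x = 0 ∧ u.p 0 x = pbar)
    {t : ℝ} (ht : t ∈ Ico 0 τ) {x : Sp n} (hx : ‖x - x₀‖ < r - s * t) :
    u.ρ t x = ρbar ∧ u.V t x = 0 ∧ u.p t x = pbar := by
  have hs : 0 < s := hc.trans hcs
  refine h.eq_const_of_subsonic_cone hγ hp hc hs.le x₀ hr ?_ hinit ht hx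
  by_contra! hbad
  obtain ⟨t₁, ht₁, x₁, hx₁, hb₁⟩ := hbad
  set m : ℝ × Sp n → ℝ := fun z =>
    min (c ^ 2 * u.ρ z.1 z.2 - γ * pbar) (s - c - ‖u.V z.1 z.2‖) with hm
  have hmc : ContinuousOn m (Ico 0 τ ×ˢ univ) :=
    ((continuousOn_const.mul h.smooth_ρ.continuousOn).sub continuousOn_const).inf
      (continuousOn_const.sub h.smooth_V.continuousOn.norm)
  set Z : Set (ℝ × Sp n) := (Icc 0 t₁ ×ˢ Metric.closedBall x₀ r) ∩
    {z | ‖z.2 - x₀‖ ≤ r - s * z.1} with hZ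
  have hsub : Icc 0 t₁ ⊆ Ico 0 τ := fun a ha => ⟨ha.1, ha.2.trans_lt ht₁.2⟩
  have hZc : IsCompact Z := (isCompact_Icc.prod (isCompact_closedBall x₀ r)).inter_right
    (isClosed_le (by fun_prop) (by fun_prop))
  have hmZ : ContinuousOn m Z := hmc.mono fun z hz => ⟨hsub hz.1.1, mem_univ _⟩
  have hbadc : IsCompact (Z ∩ m ⁻¹' Iic 0) :=
    hZc.of_isClosed_subset (hmZ.preimage_isClosed_of_isClosed hZc.isClosed isClosed_Iic)
      inter_subset_left
  have hinZ : ∀ a ∈ Icc 0 t₁, ∀ y : Sp n, ‖y - x₀‖ ≤ r - s * a → (a, y) ∈ Z :=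
    fun a ha y hy => by
      refine ⟨⟨ha, ?_⟩, hy⟩
      rw [mem_closedBall_iff_norm]
      nlinarith [ha.1]
  have hne : (Z ∩ m ⁻¹' Iic 0).Nonempty := by
    refine ⟨(t₁, x₁), hinZ t₁ (right_mem_Icc.2 ht₁.1) x₁ hx₁, ?_⟩
    simp only [hm, mem_preimage, mem_Iic, min_le_iff]
    by_contra! hcon
    linarith [hb₁ (by linarith), hcon.2]
  obtain ⟨⟨a, y⟩, ⟨⟨⟨ha, -⟩, hy⟩, hmay⟩, hmin⟩ :=
    hbadc.exists_isMinOn hne continuous_fst.continuousOn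
  simp only [mem_ofPred_eq] at hy ha
  have hconst : u.ρ a y = ρbar ∧ u.V a y = 0 := by
    rcases ha.1.eq_or_lt with rfl | ha0
    · have := hinit y (by linarith)
      exact ⟨this.1, this.2.1⟩
    have hgood : ∀ t ∈ Ico 0 a, ∀ x, ‖x - x₀‖ ≤ r - s * t →
        γ * pbar ≤ c ^ 2 * u.ρ t x ∧ ‖u.V t x‖ ≤ s - c := by
      intro t ht x hx
      by_contra hcon
      have hmem : (t, x) ∈ Z ∩ m ⁻¹' Iic 0 := by
        refine ⟨hinZ t ⟨ht.1, ht.2.le.trans ha.2⟩ x hx, ?_⟩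
        simp only [hm, mem_preimage, mem_Iic, min_le_iff]
        by_contra! hcon'
        exact hcon ⟨by linarith [hcon'.1], by linarith [hcon'.2]⟩
      have : a ≤ t := hmin hmem
      linarith [ht.2]
    have haτ : a < τ := (hsub ha).2
    have hall : ∀ t ∈ Ioo 0 a, u.ρ t y = ρbar ∧ u.V t y = 0 ∧ u.p t y = pbar := fun t ht =>
      (h.mono haτ.le).eq_const_of_subsonic_cone hγ hp hc hs.le x₀ (by nlinarith) hgood hinit
        (Ioo_subset_Ico_self ht) (by nlinarith [ht.2])
    have hsub' : Icc 0 a ⊆ Ico 0 τ := fun b hb => ⟨hb.1, hb.2.trans_lt haτ⟩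
    exact ⟨eq_of_continuousOn_Icc ha0 ((continuousOn_time h.smooth_ρ.continuousOn y).mono hsub')
        fun t ht => (hall t ht).1,
      eq_of_continuousOn_Icc ha0 ((continuousOn_time h.smooth_V.continuousOn y).mono hsub')
        fun t ht => (hall t ht).2.1⟩
  simp only [hm, mem_preimage, mem_Iic, hconst, norm_zero, min_le_iff] at hmay
  rcases hmay with h1 | h1 <;> linarith

theorem eq_const_of_far (h : IsClassicalSolution γ τ d u) (hγ : 1 < γ) {ρbar pbar R₀ : ℝ}
    (hρ : 0 < ρbar) (hp : 0 < pbar) (hd : IsPerturbation ρbar pbar R₀ d) {t : ℝ}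
    (ht : t ∈ Ico 0 τ) {x : Sp n} (hx : R₀ + soundSpeed γ ρbar pbar * t < ‖x‖) :
    u.ρ t x = ρbar ∧ u.V t x = 0 ∧ u.p t x = pbar := by
  set σ := soundSpeed γ ρbar pbar with hσ
  have hσ0 : 0 < σ := Real.sqrt_pos.2 (by positivity)
  have hσ2 : σ ^ 2 = γ * pbar / ρbar := Real.sq_sqrt (by positivity)
  obtain ⟨s, hσs, hsx⟩ : ∃ s, σ < s ∧ s * t < ‖x‖ - R₀ := by
    have hcont : Tendsto (fun s : ℝ => s * t) (𝓝[>] σ) (𝓝 (σ * t)) :=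
      ((continuous_mul_const t).tendsto σ).mono_left nhdsWithin_le_nhds
    have h1 : ∀ᶠ s in 𝓝[>] σ, s * t < ‖x‖ - R₀ := hcont.eventually_lt_const (by linarith)
    obtain ⟨s, hs1, hs2⟩ := (h1.and self_mem_nhdsWithin).exists
    exact ⟨s, hs2, hs1⟩
  have hs0 : 0 < s := hσ0.trans hσs
  set c := (σ + s) / 2 with hc
  have hσc : σ < c := by linarith
  have hcs : c < s := by linarith
  have hcρ : γ * pbar < c ^ 2 * ρbar := by
    have h1 : γ * pbar = σ ^ 2 * ρbar := by rw [hσ2]; field_simp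
    rw [h1]
    gcongr
  set τ' := min τ ((‖x‖ - R₀) / s) with hτ'
  refine (h.mono (min_le_left _ _ : τ' ≤ τ)).eq_const_of_cone hγ hp (hσ0.trans hσc) hcs hcρ x
    (r := ‖x‖ - R₀) ?_ ?_ (t := t) ⟨ht.1, lt_min ht.2 ?_⟩ ?_
  · have := min_le_right τ ((‖x‖ - R₀) / s)
    rw [le_div_iff₀ hs0] at this
    linarith
  · intro y hy
    have hfar := hd.far y (by
      rw [mem_ball_zero_iff, not_lt]
      have := norm_sub_norm_le x y
      rw [norm_sub_rev] at this
      linarith)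
    rw [h.init_ρ, h.init_V, h.init_p]
    exact hfar
  · rw [lt_div_iff₀ hs0]
    linarith
  · simp
    linarith

theorem density_pos (h : IsClassicalSolution γ τ d u) (hγ : 1 < γ) {ρbar pbar R₀ : ℝ}
    (hρ : 0 < ρbar) (hp : 0 < pbar) (hR₀ : 0 < R₀) (hd : IsPerturbation ρbar pbar R₀ d) {t : ℝ}
    (ht : t ∈ Ico 0 τ) (x : Sp n) : 0 < u.ρ t x := by
  have hσ0 : 0 ≤ soundSpeed γ ρbar pbar := Real.sqrt_nonneg _
  set r := R₀ + soundSpeed γ ρbar pbar * t with hr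
  have hfar : ∀ s ∈ Icc 0 t, ∀ y, y ∉ Metric.closedBall (0 : Sp n) r → u.ρ s y = ρbar :=
    fun s hs y hy => by
      rw [mem_closedBall_zero_iff, not_le] at hy
      refine (h.eq_const_of_far hγ hρ hp hd ⟨hs.1, hs.2.trans_lt ht.2⟩ ?_).1
      nlinarith [hs.2]
  obtain ⟨a, ha0, haρ, haini⟩ : ∃ a, 0 < a ∧ a < ρbar ∧ ∀ y, a < d.ρ₀ y := by
    obtain ⟨y₀, -, hy₀⟩ := (isCompact_closedBall (0 : Sp n) R₀).exists_isMinOn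
      ⟨0, Metric.mem_closedBall_self hR₀.le⟩ hd.smooth_ρ.continuous.continuousOn
    have h0 := hd.pos_ρ y₀
    refine ⟨min (d.ρ₀ y₀) ρbar / 2, by positivity, ?_, fun y => ?_⟩
    · linarith [min_le_right (d.ρ₀ y₀) ρbar, lt_min h0 hρ]
    · by_cases hy : y ∈ Metric.closedBall (0 : Sp n) R₀
      · have : d.ρ₀ y₀ ≤ d.ρ₀ y := hy₀ hy
        linarith [min_le_left (d.ρ₀ y₀) ρbar, lt_min h0 hρ]
      · rw [(hd.far y fun hy' => hy (Metric.ball_subset_closedBall hy')).1]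
        linarith [min_le_right (d.ρ₀ y₀) ρbar, lt_min h0 hρ]
  have hsub : Icc 0 t ⊆ Ico 0 τ := fun b hb => ⟨hb.1, hb.2.trans_lt ht.2⟩
  set Z := Icc 0 t ×ˢ Metric.closedBall (0 : Sp n) r with hZ
  have hZc : IsCompact Z := isCompact_Icc.prod (isCompact_closedBall _ _)
  obtain ⟨D, hD⟩ := hZc.exists_bound_of_continuousOn
    (h.continuousOn_divergence.mono (prod_mono hsub (subset_univ _)))
  set w : ℝ × Sp n → ℝ := fun z => Real.exp ((|D| + 1) * z.1) * u.ρ z.1 z.2 with hw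
  have hwc : ContinuousOn w (Ico 0 τ ×ˢ univ) :=
    (Continuous.continuousOn (by fun_prop)).mul h.smooth_ρ.continuousOn
  have hwfar : ∀ s ∈ Icc 0 t, ∀ y, y ∉ Metric.closedBall (0 : Sp n) r → a < w (s, y) :=
    fun s hs y hy => by
      have h1 : 1 ≤ Real.exp ((|D| + 1) * s) := Real.one_le_exp (mul_nonneg (by positivity) hs.1)
      simp only [hw, hfar s hs y hy]
      nlinarith
  have hall : ∀ s ∈ Icc 0 t, ∀ y, a < w (s, y) := by
    by_contra! hbad
    obtain ⟨t₁, ht₁, x₁, hx₁⟩ := hbad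
    have hbadc : IsCompact (Z ∩ w ⁻¹' Iic a) :=
      hZc.of_isClosed_subset ((hwc.mono (prod_mono hsub (subset_univ _))
        ).preimage_isClosed_of_isClosed hZc.isClosed isClosed_Iic) inter_subset_left
    have hmem : ∀ s ∈ Icc 0 t, ∀ y, w (s, y) ≤ a → (s, y) ∈ Z ∩ w ⁻¹' Iic a :=
      fun s hs y hy => ⟨⟨hs, by_contra fun hcon => absurd (hwfar s hs y hcon) (not_lt.2 hy)⟩, hy⟩
    obtain ⟨⟨b, y⟩, ⟨⟨hb, hyr⟩, hwb⟩, hmin⟩ :=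
      hbadc.exists_isMinOn ⟨_, hmem t₁ ht₁ x₁ hx₁⟩ continuous_fst.continuousOn
    simp only [mem_preimage, mem_Iic] at hwb hb
    have hbefore : ∀ s ∈ Ico 0 b, ∀ y, a < w (s, y) := fun s hs y => by
      by_contra hcon
      have : b ≤ s := hmin (hmem s ⟨hs.1, hs.2.le.trans hb.2⟩ y (not_lt.1 hcon))
      linarith [hs.2]
    have hb0 : 0 < b := by
      rcases hb.1.eq_or_lt with rfl | hb0
      · have : w (0, y) = d.ρ₀ y := by simp [hw, h.init_ρ]
        linarith [haini y]
      · exact hb0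
    have hbτ : b ∈ Ioo 0 τ := ⟨hb0, (hsub hb).2⟩
    have hge : ∀ y, a ≤ w (b, y) := fun y => by
      have hct : ContinuousOn (fun s => w (s, y)) (Icc 0 b) :=
        (continuousOn_time (f := fun s y => w (s, y)) hwc y).mono
          fun s hs => hsub ⟨hs.1, hs.2.trans hb.2⟩
      have h1 : Tendsto (fun s => w (s, y)) (𝓝[Ico 0 b] b) (𝓝 (w (b, y))) :=
        (hct b (right_mem_Icc.2 hb0.le)).mono Ico_subset_Icc_self
      have : (𝓝[Ico 0 b] b).NeBot := by
        rw [← mem_closure_iff_nhdsWithin_neBot, closure_Ico hb0.ne]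
        exact right_mem_Icc.2 hb0.le
      refine ge_of_tendsto h1 ?_
      filter_upwards [self_mem_nhdsWithin] with s hs
      exact (hbefore s hs y).le
    have hwa : w (b, y) = a := le_antisymm hwb (hge y)
    have hexp : 0 < Real.exp ((|D| + 1) * b) := Real.exp_pos _
    have hρb : 0 < u.ρ b y := by
      have : 0 < Real.exp ((|D| + 1) * b) * u.ρ b y := by
        have : w (b, y) = Real.exp ((|D| + 1) * b) * u.ρ b y := rfl
        linarith
      exact pos_of_mul_pos_right this hexp.le
    have hgrad : fderiv ℝ (u.ρ b) y = 0 := by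
      refine IsLocalMin.fderiv_eq_zero (Eventually.of_forall fun y' => ?_)
      have h1 : Real.exp ((|D| + 1) * b) * u.ρ b y ≤ Real.exp ((|D| + 1) * b) * u.ρ b y' :=
        hwb.trans (hge y')
      exact le_of_mul_le_mul_left h1 hexp
    have hdt : deriv (fun s => u.ρ s y) b = -(u.ρ b y * divergence (u.V b) y) := by
      have := h.material_density hbτ y
      simpa [material, pd, hgrad] using this
    have hwd : HasDerivAt (fun s => w (s, y))
        (Real.exp ((|D| + 1) * b) * ((|D| + 1) * 1) * u.ρ b y
          + Real.exp ((|D| + 1) * b) * deriv (fun s => u.ρ s y) b) b :=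
      (((hasDerivAt_id b).const_mul (|D| + 1)).exp).mul
        (differentiableAt_time h.smooth_ρ hbτ y).hasDerivAt
    have hpos : 0 < Real.exp ((|D| + 1) * b) * ((|D| + 1) * 1) * u.ρ b y
          + Real.exp ((|D| + 1) * b) * deriv (fun s => u.ρ s y) b := by
      have hDy := hD (b, y) ⟨hb, hyr⟩
      simp only [Real.norm_eq_abs] at hDy
      have h1 : 0 < |D| + 1 - divergence (u.V b) y := by
        linarith [le_abs_self (divergence (u.V b) y), le_abs_self D]
      rw [hdt]
      have : 0 < Real.exp ((|D| + 1) * b) * u.ρ b y * (|D| + 1 - divergence (u.V b) y) := by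
        positivity
      linarith
    have hslope := hwd.tendsto_slope.eventually_const_lt hpos
    have hleft : ∀ᶠ s in 𝓝[<] b, 0 < slope (fun s => w (s, y)) b s :=
      hslope.filter_mono (nhdsWithin_mono b fun s hs => ne_of_lt hs)
    obtain ⟨s, hs1, hs2⟩ := (hleft.and (Ioo_mem_nhdsLT hb0)).exists
    rw [slope_def_field, hwa] at hs1
    have h2 := hbefore s (Ioo_subset_Ico_self hs2) y
    have h3 : (w (s, y) - a) / (s - b) < 0 :=
      div_neg_of_pos_of_neg (by linarith) (by linarith [hs2.2])
    linarith
  have := ha0.trans (hall t (right_mem_Icc.2 ht.1) x)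
  exact pos_of_mul_pos_right this (Real.exp_pos _).le

end IsClassicalSolution

end Propagation

section Profile

variable {n : ℕ} {R k : ℝ}

theorem Bc_pos (hR : 0 < R) (hk : 1 < k) : 0 < Bc R k := by
  have : 0 < k - 1 := by linarith
  unfold Bc
  positivity

theorem phi_nonneg (hR : 0 < R) (hk : 1 < k) {r : ℝ} (hr : 0 ≤ r) : 0 ≤ phi R k r := by
  have hk1 : 0 < k - 1 := by linarith
  have hB := Bc_pos hR hk
  unfold phi
  split_ifs with h1 h2
  · have h3 : r ^ 2 ≤ (R - R / k) ^ 2 := by gcongr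
    have h4 : Bc R k * (R - R / k) ^ 2 = (k - 1) / k := by
      unfold Bc
      field_simp
    have h5 : (k - 1) / k ≤ 1 := by rw [div_le_one (by linarith)]; linarith
    nlinarith
  · unfold Cc
    positivity
  · exact le_rfl

theorem integrable_phi (R k : ℝ) : Integrable fun x : Sp n => phi R k ‖x‖ := by
  have h1 : IntegrableOn (fun x : Sp n => 1 - Bc R k * ‖x‖ ^ 2) {x | ‖x‖ < R - R / k} :=
    ((Continuous.continuousOn (by fun_prop)).integrableOn_compact
      (isCompact_closedBall (0 : Sp n) (R - R / k))).mono_set fun x hx => by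
        simpa using (show ‖x‖ < R - R / k from hx).le
  have h2 : IntegrableOn (fun x : Sp n => Cc R k * (‖x‖ - R) ^ 2)
      ({x | ‖x‖ < R - R / k}ᶜ ∩ {x | ‖x‖ ≤ R}) :=
    ((Continuous.continuousOn (by fun_prop)).integrableOn_compact
      (isCompact_closedBall (0 : Sp n) R)).mono_set fun x hx => by
        simpa using (show ‖x‖ ≤ R from hx.2)
  have m1 : MeasurableSet {x : Sp n | ‖x‖ < R - R / k} :=
    measurableSet_lt measurable_norm measurable_const
  have m2 : MeasurableSet {x : Sp n | ‖x‖ ≤ R} := measurableSet_le measurable_norm measurable_const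
  refine ((h1.integrable_indicator m1).add
    (h2.integrable_indicator (m1.compl.inter m2))).congr (Eventually.of_forall fun x => ?_)
  simp only [Pi.add_apply, indicator_apply, mem_inter_iff, mem_compl_iff, mem_ofPred_eq, phi]
  split_ifs <;> simp_all

theorem deriv_phi {r : ℝ} (hr : r < R - R / k) : deriv (phi R k) r = -2 * Bc R k * r := by
  have h1 : phi R k =ᶠ[𝓝 r] fun r => 1 - Bc R k * r ^ 2 := by
    filter_upwards [Iio_mem_nhds hr] with s hs
    simp [phi, mem_Iio.1 hs]
  have h2 : HasDerivAt (fun r : ℝ => 1 - Bc R k * r ^ 2) (-(Bc R k * (2 * r))) r := by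
    simpa using ((hasDerivAt_pow 2 r).const_mul (Bc R k)).const_sub 1
  rw [h1.deriv_eq, h2.deriv]
  ring

theorem momentRate_eq {R₀ : ℝ} (hR₀ : R₀ < R - R / k) (ρ : Sp n → ℝ) {V : Sp n → Sp n}
    (hV : ∀ x, R₀ < ‖x‖ → V x = 0) :
    momentRate R k ρ V = -2 * Bc R k * ∫ x, ρ x * inner ℝ (V x) x := by
  rw [momentRate, ← integral_const_mul]
  refine integral_congr_ae (Eventually.of_forall fun x => ?_)
  simp only
  rcases lt_or_ge R₀ ‖x‖ with hx | hx
  · simp [hV x hx]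
  rcases eq_or_ne x 0 with rfl | hx0
  · simp
  have : ‖x‖ ≠ 0 := by simpa using hx0
  rw [deriv_phi (hx.trans_lt hR₀)]
  field_simp

/-- The moment is bounded below by the contribution of the outer part of the profile. -/
theorem exists_moment_lower_bound (hn : 1 ≤ n) (hR : 0 < R) (hk : 1 < k) {ρbar : ℝ}
    (hρbar : 0 < ρbar) : ∃ c, 0 < c ∧ ∀ ρ : Sp n → ℝ, Continuous ρ → (∀ x, 0 ≤ ρ x) →
      (∀ x, R - R / k ≤ ‖x‖ → ρ x = ρbar) → c ≤ moment R k ρ := by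
  have hkR : 0 < R / k := by positivity
  set r₁ := R - R / k with hr₁
  have m1 : MeasurableSet {x : Sp n | ‖x‖ < r₁} :=
    measurableSet_lt measurable_norm measurable_const
  set g : Sp n → ℝ := {x : Sp n | ‖x‖ < r₁}ᶜ.indicator fun x => phi R k ‖x‖ with hg
  have hgI : Integrable g := (integrable_phi R k).indicator m1.compl
  have hphi : ∀ x : Sp n, 0 ≤ phi R k ‖x‖ := fun x => phi_nonneg hR hk (norm_nonneg x)
  have hg0 : ∀ x, 0 ≤ g x := fun x => indicator_nonneg (fun x _ => hphi x) x
  have hpos : 0 < ∫ x, g x := by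
    rw [integral_pos_iff_support_of_nonneg hg0 hgI]
    have hopen : IsOpen {x : Sp n | r₁ < ‖x‖ ∧ ‖x‖ < R} :=
      (isOpen_lt continuous_const continuous_norm).inter
        (isOpen_lt continuous_norm continuous_const)
    have hne : {x : Sp n | r₁ < ‖x‖ ∧ ‖x‖ < R}.Nonempty := by
      have h0 : 0 ≤ R - R / (2 * k) := by
        rw [sub_nonneg, div_le_iff₀ (by positivity)]
        nlinarith
      refine ⟨EuclideanSpace.single ⟨0, hn⟩ (R - R / (2 * k)), ?_⟩
      have h2 : R / (2 * k) = R / k / 2 := by field_simp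
      simp only [mem_ofPred_eq, PiLp.norm_single, Real.norm_eq_abs, abs_of_nonneg h0]
      constructor <;> linarith
    refine (hopen.measure_pos volume hne).trans_le (measure_mono fun x hx => ?_)
    have hx1 : ¬ ‖x‖ < r₁ := not_lt.2 hx.1.le
    have hC : 0 < Cc R k := mul_pos (Bc_pos hR hk) (by linarith)
    have hxR : ‖x‖ - R ≠ 0 := by linarith [hx.2]
    rw [Function.mem_support, hg, indicator_of_mem (by simpa using hx.1.le), phi, if_neg hx1,
      if_pos hx.2.le]
    positivity
  refine ⟨ρbar * ∫ x, g x, mul_pos hρbar hpos, fun ρ hρc hρ0 hρ => ?_⟩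
  have hI : Integrable fun x => ρ x * phi R k ‖x‖ := by
    obtain ⟨C, hC⟩ := (isCompact_closedBall (0 : Sp n) R).exists_bound_of_continuousOn
      hρc.continuousOn
    refine ((integrable_phi R k).const_mul C).mono'
      (hρc.aestronglyMeasurable.mul (integrable_phi R k).1) (Eventually.of_forall fun x => ?_)
    rw [norm_mul, Real.norm_of_nonneg (hphi x)]
    rcases le_or_gt ‖x‖ R with hx | hx
    · exact mul_le_mul_of_nonneg_right (hC x (by simpa using hx)) (hphi x)
    · have : phi R k ‖x‖ = 0 := by
        rw [phi, if_neg (by linarith), if_neg (by linarith)]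
      simp [this]
  rw [moment, ← integral_const_mul]
  refine integral_mono (hgI.const_mul _) hI fun x => ?_
  simp only
  by_cases hx : ‖x‖ < r₁
  · rw [hg, indicator_of_notMem (by simpa using hx), mul_zero]
    exact mul_nonneg (hρ0 x) (hphi x)
  · rw [hg, indicator_of_mem (by simpa using hx), hρ x (not_lt.1 hx)]

end Profile

section Moments

variable {n : ℕ} {γ τ : ℝ} {d : Data n} {u : Flow n}

theorem c1_of_space {g : Sp n → ℝ} (hg : ContDiff ℝ 1 g) : C1 τ fun _ x => g x :=
  (hg.comp contDiff_snd).contDiffOn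

theorem material_of_space (V : ℝ → Sp n → Sp n) (g : Sp n → ℝ) (t : ℝ) (x : Sp n) :
    material V (fun _ x => g x) t x = ∑ j, V t x j * pd j g x := by
  simp [material]

theorem inner_eq_sum_mul (v x : Sp n) : inner ℝ v x = ∑ i, v i * x i := by
  rw [PiLp.inner_apply]
  exact Finset.sum_congr rfl fun i _ => by simp [mul_comm]

theorem contDiff_coord_fun (i : Fin n) : ContDiff ℝ 1 fun x : Sp n => x i :=
  contDiff_euclidean.1 contDiff_id i

/-- On `[0, τ)`, the flow is at rest with density `ρbar` and pressure `pbar` outside the ball of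
radius `r`. -/
def RestOutside {n : ℕ} (ρbar pbar r τ : ℝ) (u : Flow n) : Prop :=
  ∀ t ∈ Ico 0 τ, ∀ x, x ∉ Metric.closedBall (0 : Sp n) r →
    u.ρ t x = ρbar ∧ u.V t x = 0 ∧ u.p t x = pbar

namespace IsClassicalSolution

variable {ρbar pbar r : ℝ}

theorem hasDerivAt_weighted_mass (h : IsClassicalSolution γ τ d u)
    (hout : RestOutside ρbar pbar r τ u) (B : ℝ) {t : ℝ} (ht : t ∈ Ioo 0 τ) :
    HasDerivAt (fun t => ∫ x, (u.ρ t x - ρbar) * (1 - B * ‖x‖ ^ 2))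
      (-2 * B * ∫ x, u.ρ t x * inner ℝ (u.V t x) x) t := by
  have hgc : ContDiff ℝ 1 fun x : Sp n => 1 - B * ‖x‖ ^ 2 :=
    contDiff_const.sub (contDiff_const.mul (contDiff_id.norm_sq ℝ))
  have hg : C1 τ fun _ (x : Sp n) => 1 - B * ‖x‖ ^ 2 := c1_of_space hgc
  have hρg : C1 τ fun t x => u.ρ t x * (1 - B * ‖x‖ ^ 2) := h.smooth_ρ.mul hg
  rw [← integral_const_mul]
  refine (hasDerivAt_integral_of_balance (isCompact_closedBall (0 : Sp n) r)
    (a := fun t x => (u.ρ t x - ρbar) * (1 - B * ‖x‖ ^ 2))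
    (b := fun j t x => u.ρ t x * (1 - B * ‖x‖ ^ 2) * u.V t x j)
    ((h.smooth_ρ.sub contDiffOn_const).mul hg) (fun j => hρg.mul (h.c1_V j)) ?_ ?_ ht
    fun x => ?_).2
  · intro t ht x hx
    simp [(hout t (Ioo_subset_Ico_self ht) x hx).1]
  · intro j t ht x hx
    simp [(hout t (Ioo_subset_Ico_self ht) x hx).2.1]
  · have h1 : deriv (fun s => (u.ρ s x - ρbar) * (1 - B * ‖x‖ ^ 2)) t
        = deriv (fun s => u.ρ s x * (1 - B * ‖x‖ ^ 2)) t := by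
      rw [deriv_mul_const_field, deriv_mul_const_field, deriv_sub_const]
    have h2 : ∀ j, pd j (fun x : Sp n => 1 - B * ‖x‖ ^ 2) x = -2 * B * x j := fun j => by
      have h3 := pd_norm_sq j 0 x
      simp only [sub_zero, PiLp.zero_apply] at h3
      have hd : DifferentiableAt ℝ (fun y : Sp n => ‖y‖ ^ 2) x :=
        (contDiff_id.norm_sq ℝ : ContDiff ℝ 1 fun y : Sp n => ‖y‖ ^ 2).differentiable (by simp) x
      have h4 := (((hd.hasFDerivAt).const_mul B).const_sub 1).fderiv
      rw [pd] at h3 ⊢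
      rw [h4]
      simp only [smul_apply, neg_apply, smul_eq_mul, h3]
      ring
    rw [h1, deriv_add_sum_pd_mul_velocity hρg h.c1_V ht x,
      material_mul u.V h.smooth_ρ hg ht x, material_of_space, h.material_density ht x,
      inner_eq_sum_mul]
    simp only [h2, Finset.mul_sum]
    have h5 : ∀ j, u.ρ t x * (u.V t x j * (-2 * B * x j))
        = -2 * B * (u.ρ t x * (u.V t x j * x j)) := fun j => by ring
    simp only [h5]
    ring

theorem c1_inner (h : IsClassicalSolution γ τ d u) : C1 τ fun t x => inner ℝ (u.V t x) x :=
  h.smooth_V.inner ℝ contDiff_snd.contDiffOn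

theorem material_inner (h : IsClassicalSolution γ τ d u) {t : ℝ} (ht : t ∈ Ioo 0 τ) (x : Sp n) :
    u.ρ t x * material u.V (fun t x => inner ℝ (u.V t x) x) t x
      = u.ρ t x * ‖u.V t x‖ ^ 2 - ∑ i, pd i (u.p t) x * x i := by
  have hx : ∀ i, C1 τ fun _ (x : Sp n) => x i := fun i => c1_of_space (contDiff_coord_fun i)
  simp only [inner_eq_sum_mul]
  rw [material_sum Finset.univ u.V (f := fun i t x => u.V t x i * x i)
    (fun i _ => (h.c1_V i).mul (hx i)) ht x, EuclideanSpace.real_norm_sq_eq, Finset.mul_sum,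
    Finset.mul_sum, ← Finset.sum_sub_distrib]
  refine Finset.sum_congr rfl fun i _ => ?_
  rw [material_mul u.V (h.c1_V i) (hx i) ht x, material_of_space]
  simp only [pd_coord, mul_ite, mul_one, mul_zero, Finset.sum_ite_eq, Finset.mem_univ, if_true]
  linear_combination x i * h.material_velocity ht x i

theorem hasDerivAt_radial_momentum (h : IsClassicalSolution γ τ d u)
    (hout : RestOutside ρbar pbar r τ u) {t : ℝ} (ht : t ∈ Ioo 0 τ) :
    HasDerivAt (fun t => ∫ x, u.ρ t x * inner ℝ (u.V t x) x)
      (∫ x, (u.ρ t x * ‖u.V t x‖ ^ 2 + n * (u.p t x - pbar))) t := by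
  have hρI : C1 τ fun t x => u.ρ t x * inner ℝ (u.V t x) x := h.smooth_ρ.mul h.c1_inner
  have hP := h.c1_devPressure pbar
  have hx : ∀ i, C1 τ fun _ (x : Sp n) => x i := fun i => c1_of_space (contDiff_coord_fun i)
  have hPx : ∀ j, C1 τ fun t x => (u.p t x - pbar) * x j := fun j => hP.mul (hx j)
  have hIV : ∀ j, C1 τ fun t x => u.ρ t x * inner ℝ (u.V t x) x * u.V t x j := fun j =>
    hρI.mul (h.c1_V j)
  refine (hasDerivAt_integral_of_balance (isCompact_closedBall (0 : Sp n) r)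
    (a := fun t x => u.ρ t x * inner ℝ (u.V t x) x)
    (b := fun j t x => u.ρ t x * inner ℝ (u.V t x) x * u.V t x j + (u.p t x - pbar) * x j)
    hρI (fun j => (hIV j).add (hPx j)) ?_ ?_ ht fun x => ?_).2
  · intro t ht x hx
    simp [(hout t (Ioo_subset_Ico_self ht) x hx).2.1]
  · intro j t ht x hx
    simp [(hout t (Ioo_subset_Ico_self ht) x hx).2]
  · simp only [pd_add _ ((hIV _).pd_diff ht x) ((hPx _).pd_diff ht x), Finset.sum_add_distrib]
    rw [← add_assoc, deriv_add_sum_pd_mul_velocity hρI h.c1_V ht x,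
      material_mul u.V h.smooth_ρ h.c1_inner ht x, h.material_density ht x, h.material_inner ht x]
    simp only [pd_mul _ (hP.pd_diff ht x) ((hx _).pd_diff ht x), pd_coord, pd_sub_const, if_true,
      Finset.sum_add_distrib, mul_one, Finset.sum_const, Finset.card_univ, Fintype.card_fin,
      nsmul_eq_mul]
    ring

/-- The total energy relative to the constant state is conserved. -/
theorem energy_conservation (h : IsClassicalSolution γ τ d u) (hγ : 1 < γ)
    (hout : RestOutside ρbar pbar r τ u) {t : ℝ} (ht : t ∈ Ico 0 τ) :
    ∫ x, (1 / 2 * (u.ρ t x * ‖u.V t x‖ ^ 2) + 1 / (γ - 1) * (u.p t x - pbar))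
      = ∫ x, (1 / 2 * (u.ρ 0 x * ‖u.V 0 x‖ ^ 2) + 1 / (γ - 1) * (u.p 0 x - pbar)) := by
  rcases ht.1.eq_or_lt with rfl | ht0
  · rfl
  have hγ1 : γ - 1 ≠ 0 := by linarith
  have hK : C1 τ fun t x => 1 / 2 * (u.ρ t x * ‖u.V t x‖ ^ 2) := contDiffOn_const.mul h.c1_kinetic
  have hp' : C1 τ fun t x => 1 / (γ - 1) * u.p t x := contDiffOn_const.mul h.smooth_p
  have hf : C1 τ fun t x => 1 / 2 * (u.ρ t x * ‖u.V t x‖ ^ 2) + 1 / (γ - 1) * u.p t x :=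
    hK.add hp'
  have ha : C1 τ fun t x => 1 / 2 * (u.ρ t x * ‖u.V t x‖ ^ 2) + 1 / (γ - 1) * (u.p t x - pbar) :=
    hK.add (contDiffOn_const.mul (h.c1_devPressure pbar))
  have hfV : ∀ j, C1 τ fun t x => (1 / 2 * (u.ρ t x * ‖u.V t x‖ ^ 2) + 1 / (γ - 1) * u.p t x)
      * u.V t x j := fun j => hf.mul (h.c1_V j)
  have hpV : ∀ j, C1 τ fun t x => u.p t x * u.V t x j := fun j => h.smooth_p.mul (h.c1_V j)
  have hcont : ContinuousOn (fun t => ∫ x, (1 / 2 * (u.ρ t x * ‖u.V t x‖ ^ 2)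
      + 1 / (γ - 1) * (u.p t x - pbar))) (Ico 0 τ) :=
    continuousOn_integral_of_compact_support (isCompact_closedBall (0 : Sp n) r) ha.continuousOn
      (fun t x ht hx => by simp [hout t ht x hx])
  have hd : ∀ s ∈ Ioo 0 t, HasDerivAt (fun t => ∫ x, (1 / 2 * (u.ρ t x * ‖u.V t x‖ ^ 2)
      + 1 / (γ - 1) * (u.p t x - pbar))) 0 s := fun s hs => by
    have hs' : s ∈ Ioo 0 τ := ⟨hs.1, hs.2.trans ht.2⟩
    have := (hasDerivAt_integral_of_balance (isCompact_closedBall (0 : Sp n) r)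
      (a := fun t x => 1 / 2 * (u.ρ t x * ‖u.V t x‖ ^ 2) + 1 / (γ - 1) * (u.p t x - pbar))
      (b := fun j t x => (1 / 2 * (u.ρ t x * ‖u.V t x‖ ^ 2) + 1 / (γ - 1) * u.p t x) * u.V t x j
        + u.p t x * u.V t x j) (c := fun _ => 0)
      ha (fun j => (hfV j).add (hpV j))
      (fun t ht x hx => by simp [hout t (Ioo_subset_Ico_self ht) x hx])
      (fun j t ht x hx => by simp [hout t (Ioo_subset_Ico_self ht) x hx]) hs' fun x => ?_).2
    · simpa using this
    · have h1 : deriv (fun s => 1 / 2 * (u.ρ s x * ‖u.V s x‖ ^ 2) + 1 / (γ - 1) * (u.p s x - pbar))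
          s = deriv (fun s => 1 / 2 * (u.ρ s x * ‖u.V s x‖ ^ 2) + 1 / (γ - 1) * u.p s x) s := by
        have : (fun s => 1 / 2 * (u.ρ s x * ‖u.V s x‖ ^ 2) + 1 / (γ - 1) * (u.p s x - pbar))
            = fun s => 1 / 2 * (u.ρ s x * ‖u.V s x‖ ^ 2) + 1 / (γ - 1) * u.p s x
              - 1 / (γ - 1) * pbar := by
          funext s
          ring
        rw [this, deriv_sub_const]
      rw [h1]
      simp only [pd_add _ ((hfV _).pd_diff hs' x) ((hpV _).pd_diff hs' x), Finset.sum_add_distrib]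
      rw [← add_assoc, deriv_add_sum_pd_mul_velocity hf h.c1_V hs' x,
        sum_pd_mul_velocity h.smooth_p h.c1_V hs' x, material_add u.V hK hp' hs' x,
        material_const_mul u.V h.c1_kinetic _ hs' x, material_const_mul u.V h.smooth_p _ hs' x,
        h.material_kinetic hs' x, h.material_pressure hγ hs' x]
      field_simp
      ring
  obtain ⟨c, -, hc⟩ := exists_hasDerivAt_eq_slope _ (fun _ => (0 : ℝ)) ht0
    (hcont.mono fun s hs => ⟨hs.1, hs.2.trans_lt ht.2⟩) hd
  have h3 := (eq_div_iff (by linarith : t - 0 ≠ 0)).1 hc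
  linarith

end IsClassicalSolution

end Moments

section Blowup

variable {n : ℕ} {γ τ : ℝ} {d : Data n} {u : Flow n} {ρbar pbar r R₀ R k : ℝ}

theorem volume_closedBall_toReal (hr : 0 ≤ r) :
    (volume (Metric.closedBall (0 : Sp n) r)).toReal = omega n * r ^ n := by
  rw [Measure.addHaar_closedBall _ _ hr, omega, ENNReal.toReal_mul,
    ENNReal.toReal_ofReal (by positivity)]
  simp [mul_comm]

theorem excessEnergy_eq (hd : IsPerturbation ρbar pbar R₀ d) :
    excessEnergy γ pbar R₀ d
      = ∫ x, (1 / 2 * (d.ρ₀ x * ‖d.V₀ x‖ ^ 2) + 1 / (γ - 1) * (d.p₀ x - pbar)) := by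
  have hfar : ∀ x, x ∉ Metric.closedBall (0 : Sp n) R₀ →
      d.ρ₀ x = ρbar ∧ d.V₀ x = 0 ∧ d.p₀ x = pbar := fun x hx =>
    hd.far x fun hx' => hx (Metric.ball_subset_closedBall hx')
  have hc := isCompact_closedBall (0 : Sp n) R₀
  have h1 : Integrable fun x => d.ρ₀ x * ‖d.V₀ x‖ ^ 2 :=
    integrable_of_eq_zero_off_compact
      (hd.smooth_ρ.continuous.mul (hd.smooth_V.continuous.norm.pow 2)) hc
      fun x hx => by simp [hfar x hx]
  have h2 : Integrable fun x => d.p₀ x - pbar :=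
    integrable_of_eq_zero_off_compact (hd.smooth_p.continuous.sub continuous_const) hc
      fun x hx => by simp [hfar x hx]
  rw [excessEnergy, setIntegral_eq_integral_of_forall_compl_eq_zero
    fun x hx => by simp [(hd.far x hx).2.2], integral_add (h1.const_mul _) (h2.const_mul _),
    integral_const_mul, integral_const_mul]

namespace IsClassicalSolution

theorem restOutside (h : IsClassicalSolution γ τ d u) (hγ : 1 < γ) (hρ : 0 < ρbar)
    (hp : 0 < pbar) (hd : IsPerturbation ρbar pbar R₀ d) :
    RestOutside ρbar pbar (R₀ + soundSpeed γ ρbar pbar * τ) τ u := fun t ht x hx => by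
  rw [mem_closedBall_zero_iff, not_le] at hx
  have hσ0 : 0 ≤ soundSpeed γ ρbar pbar := Real.sqrt_nonneg _
  exact h.eq_const_of_far hγ hρ hp hd ht (by nlinarith [ht.2])

theorem pressure_pos (h : IsClassicalSolution γ τ d u) {t : ℝ} (ht : t ∈ Ico 0 τ) {x : Sp n}
    (hx : 0 < u.ρ t x) : 0 < u.p t x := by
  rw [h.state t ht x]
  exact mul_pos (Real.exp_pos _) (Real.rpow_pos_of_pos hx γ)

/-- The virial `∫ ρ |V|² + n (p - pbar)` is bounded below by a constant of the motion. -/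
theorem virial_ge (h : IsClassicalSolution γ τ d u) (hγ : 1 < γ) (hρ : 0 < ρbar)
    (hp : 0 < pbar) (hR₀ : 0 < R₀) (hd : IsPerturbation ρbar pbar R₀ d)
    (hout : RestOutside ρbar pbar r τ u) (hrk : r ≤ (k - 1) * R / k)
    (hRk : 0 ≤ (k - 1) * R / k) {t : ℝ} (ht : t ∈ Ico 0 τ) :
    Nc γ pbar R₀ R k d ≤ ∫ x, (u.ρ t x * ‖u.V t x‖ ^ 2 + n * (u.p t x - pbar)) := by
  have hγ1 : 0 < γ - 1 := by linarith
  have h0 : (0 : ℝ) ∈ Ico 0 τ := ⟨le_rfl, ht.1.trans_lt ht.2⟩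
  have hc := isCompact_closedBall (0 : Sp n) r
  have hρ0 : ∀ x, 0 < u.ρ t x := h.density_pos hγ hρ hp hR₀ hd ht
  have hKc : Continuous fun x => u.ρ t x * ‖u.V t x‖ ^ 2 :=
    (contDiff_slice (f := fun t x => u.ρ t x * ‖u.V t x‖ ^ 2) h.c1_kinetic ht).continuous
  have hPc : Continuous fun x => u.p t x - pbar :=
    (contDiff_slice (f := fun t x => u.p t x - pbar) (h.c1_devPressure pbar) ht).continuous
  have hK : Integrable fun x => u.ρ t x * ‖u.V t x‖ ^ 2 :=
    integrable_of_eq_zero_off_compact hKc hc fun x hx => by simp [hout t ht x hx]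
  have hP : Integrable fun x => u.p t x - pbar :=
    integrable_of_eq_zero_off_compact hPc hc fun x hx => by simp [hout t ht x hx]
  have hE := h.energy_conservation hγ hout ht
  simp only [h.init_ρ, h.init_V, h.init_p] at hE
  rw [← excessEnergy_eq hd, integral_add (hK.const_mul _) (hP.const_mul _), integral_const_mul,
    integral_const_mul] at hE
  rw [integral_add hK (hP.const_mul _), integral_const_mul, Nc, ← hE]
  set I := ∫ x, (u.p t x - pbar) with hI
  set Ek := ∫ x, u.ρ t x * ‖u.V t x‖ ^ 2 with hEk
  have hEk0 : 0 ≤ Ek := integral_nonneg fun x => mul_nonneg (hρ0 x).le (by positivity)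
  have hIW : -(omega n * R ^ n * pbar * ((k - 1) / k) ^ n) ≤ I := by
    have hvol := volume_closedBall_toReal (n := n) hRk
    have h1 : I = ∫ x in Metric.closedBall (0 : Sp n) ((k - 1) * R / k), (u.p t x - pbar) :=
      (setIntegral_eq_integral_of_forall_compl_eq_zero fun x hx => by
        simp [hout t ht x fun hx' => hx (Metric.closedBall_subset_closedBall hrk hx')]).symm
    have h2 : ∫ x in Metric.closedBall (0 : Sp n) ((k - 1) * R / k), -pbar
        = -(omega n * R ^ n * pbar * ((k - 1) / k) ^ n) := by
      rw [setIntegral_const, measureReal_def, hvol, smul_eq_mul,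
        show (k - 1) * R / k = R * ((k - 1) / k) by ring, mul_pow]
      ring
    rw [h1, ← h2]
    refine integral_mono (integrableOn_const (measure_closedBall_lt_top).ne) hP.integrableOn
      fun x => ?_
    have := h.pressure_pos ht (hρ0 x)
    simp only
    linarith
  have hδ2 : delta n γ ≤ 2 := min_le_left _ _
  have hδn : delta n γ / (γ - 1) ≤ n := by
    rw [div_le_iff₀ hγ1]
    exact min_le_right _ _
  have h3 : 0 ≤ (n - delta n γ / (γ - 1)) *
      (I + omega n * R ^ n * pbar * ((k - 1) / k) ^ n) :=
    mul_nonneg (by linarith) (by linarith)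
  have h4 : 0 ≤ (2 - delta n γ) * Ek := mul_nonneg (by linarith) hEk0
  have h5 : delta n γ * (1 / 2 * Ek + 1 / (γ - 1) * I)
      = 1 / 2 * (delta n γ * Ek) + delta n γ / (γ - 1) * I := by ring
  rw [h5]
  nlinarith

theorem continuousOn_radial_momentum (h : IsClassicalSolution γ τ d u)
    (hout : RestOutside ρbar pbar r τ u) :
    ContinuousOn (fun t => ∫ x, u.ρ t x * inner ℝ (u.V t x) x) (Ico 0 τ) :=
  continuousOn_integral_of_compact_support (isCompact_closedBall (0 : Sp n) r)
    (h.smooth_ρ.mul h.c1_inner).continuousOn fun t x ht hx => by simp [hout t ht x hx]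

theorem moment_eq (h : IsClassicalSolution γ τ d u) (hout : RestOutside ρbar pbar r τ u)
    (hr : r < R - R / k) {t : ℝ} (ht : t ∈ Ico 0 τ) :
    moment R k (u.ρ t) = ρbar * (∫ x : Sp n, phi R k ‖x‖)
      + ∫ x, (u.ρ t x - ρbar) * (1 - Bc R k * ‖x‖ ^ 2) := by
  have hI : Integrable fun x => (u.ρ t x - ρbar) * (1 - Bc R k * ‖x‖ ^ 2) := by
    refine integrable_of_eq_zero_off_compact ?_ (isCompact_closedBall (0 : Sp n) r)
      fun x hx => by simp [hout t ht x hx]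
    have := (contDiff_slice h.smooth_ρ ht).continuous
    fun_prop
  rw [moment, ← integral_const_mul, ← integral_add ((integrable_phi R k).const_mul _) hI]
  refine integral_congr_ae (Eventually.of_forall fun x => ?_)
  simp only
  by_cases hx : x ∈ Metric.closedBall (0 : Sp n) r
  · have : ‖x‖ < R - R / k := (mem_closedBall_zero_iff.1 hx).trans_lt hr
    rw [phi, if_pos this]
    ring
  · rw [(hout t ht x hx).1]
    ring

theorem continuousOn_moment (h : IsClassicalSolution γ τ d u)
    (hout : RestOutside ρbar pbar r τ u) (hr : r < R - R / k) :
    ContinuousOn (fun t => moment R k (u.ρ t)) (Ico 0 τ) := by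
  have hg : C1 τ fun _ (x : Sp n) => 1 - Bc R k * ‖x‖ ^ 2 :=
    c1_of_space (contDiff_const.sub (contDiff_const.mul (contDiff_id.norm_sq ℝ)))
  have h1 : ContinuousOn (fun t => ∫ x, (u.ρ t x - ρbar) * (1 - Bc R k * ‖x‖ ^ 2)) (Ico 0 τ) :=
    continuousOn_integral_of_compact_support (isCompact_closedBall (0 : Sp n) r)
      ((h.smooth_ρ.sub contDiffOn_const).mul hg).continuousOn
      fun t x ht hx => by simp [hout t ht x hx]
  exact (continuousOn_const.add h1).congr fun t ht => h.moment_eq hout hr ht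

theorem hasDerivAt_moment (h : IsClassicalSolution γ τ d u)
    (hout : RestOutside ρbar pbar r τ u) (hr : r < R - R / k) {t : ℝ} (ht : t ∈ Ioo 0 τ) :
    HasDerivAt (fun t => moment R k (u.ρ t))
      (-2 * Bc R k * ∫ x, u.ρ t x * inner ℝ (u.V t x) x) t := by
  refine ((h.hasDerivAt_weighted_mass hout (Bc R k) ht).const_add
    (ρbar * ∫ x : Sp n, phi R k ‖x‖)).congr_of_eventuallyEq ?_
  filter_upwards [Ioo_mem_nhds ht.1 ht.2] with s hs
  exact h.moment_eq hout hr (Ioo_subset_Ico_self hs)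

theorem momentRate_initial (h : IsClassicalSolution γ τ d u)
    (hd : IsPerturbation ρbar pbar R₀ d) (hR₀ : R₀ < R - R / k) :
    momentRate R k d.ρ₀ d.V₀ = -2 * Bc R k * ∫ x, u.ρ 0 x * inner ℝ (u.V 0 x) x := by
  simp only [h.init_ρ, h.init_V]
  refine momentRate_eq hR₀ _ fun x hx => (hd.far x ?_).2.1
  rw [mem_ball_zero_iff]
  linarith

theorem hasDerivWithinAt_moment (h : IsClassicalSolution γ τ d u) (hτ : 0 < τ)
    (hd : IsPerturbation ρbar pbar R₀ d) (hR₀ : R₀ < R - R / k)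
    (hout : RestOutside ρbar pbar r τ u) (hr : r < R - R / k) :
    HasDerivWithinAt (fun t => moment R k (u.ρ t)) (momentRate R k d.ρ₀ d.V₀) (Ici 0) 0 := by
  have h0 : (0 : ℝ) ∈ Ico 0 τ := ⟨le_rfl, hτ⟩
  refine hasDerivWithinAt_Ici_of_tendsto_deriv (s := Ioo 0 τ)
    (fun t ht => (h.hasDerivAt_moment hout hr ht).differentiableAt.differentiableWithinAt)
    ((h.continuousOn_moment hout hr 0 h0).mono Ioo_subset_Ico_self) (Ioo_mem_nhdsGT hτ) ?_
  rw [h.momentRate_initial hd hR₀]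
  have h1 : Tendsto (fun t => -2 * Bc R k * ∫ x, u.ρ t x * inner ℝ (u.V t x) x) (𝓝[>] 0)
      (𝓝 (-2 * Bc R k * ∫ x, u.ρ 0 x * inner ℝ (u.V 0 x) x)) := by
    refine Tendsto.const_mul _ ?_
    have h2 := h.continuousOn_radial_momentum hout 0 h0
    rw [← nhdsWithin_Ioo_eq_nhdsGT hτ]
    exact h2.mono Ioo_subset_Ico_self
  refine h1.congr' ?_
  filter_upwards [Ioo_mem_nhdsGT hτ] with t ht
  exact (h.hasDerivAt_moment hout hr ht).deriv.symm

theorem moment_le (h : IsClassicalSolution γ τ d u) (hγ : 1 < γ) (hρ : 0 < ρbar)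
    (hp : 0 < pbar) (hR : 0 < R) (hk : 1 < k) (hR₀ : 0 < R₀) (hR₀k : R₀ < R - R / k)
    (hd : IsPerturbation ρbar pbar R₀ d)
    (hout : RestOutside ρbar pbar r τ u) (hr : r < R - R / k) {t : ℝ} (ht : t ∈ Ico 0 τ) :
    moment R k (u.ρ t) ≤ moment R k d.ρ₀ + momentRate R k d.ρ₀ d.V₀ * t
      - Bc R k * Nc γ pbar R₀ R k d * t ^ 2 := by
  have hkR : (k - 1) * R / k = R - R / k := by field_simp
  set N := Nc γ pbar R₀ R k d with hN
  set B := Bc R k with hB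
  have hB0 : 0 < B := Bc_pos hR hk
  set H : ℝ → ℝ := fun t => ∫ x, u.ρ t x * inner ℝ (u.V t x) x with hH
  have h0 : (0 : ℝ) ∈ Ico 0 τ := ⟨le_rfl, ht.1.trans_lt ht.2⟩
  have hHd : ∀ s ∈ Ioo 0 τ, HasDerivAt (fun s => H s - N * s)
      ((∫ x, (u.ρ s x * ‖u.V s x‖ ^ 2 + n * (u.p s x - pbar))) - N * 1) s := fun s hs =>
    (h.hasDerivAt_radial_momentum hout hs).sub ((hasDerivAt_id s).const_mul N)
  have hHmono : MonotoneOn (fun s => H s - N * s) (Ico 0 τ) := by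
    refine monotoneOn_of_deriv_nonneg (convex_Ico 0 τ)
      ((h.continuousOn_radial_momentum hout).sub (Continuous.continuousOn (by fun_prop))) ?_ ?_
    · rw [interior_Ico]
      exact fun s hs => (hHd s hs).differentiableAt.differentiableWithinAt
    · rw [interior_Ico]
      intro s hs
      rw [(hHd s hs).deriv]
      have := h.virial_ge (R := R) (k := k) hγ hρ hp hR₀ hd hout (by rw [hkR]; exact hr.le)
        (by rw [hkR]; linarith) (Ioo_subset_Ico_self hs)
      linarith
  have hG₁ : momentRate R k d.ρ₀ d.V₀ = -2 * B * H 0 := h.momentRate_initial hd hR₀k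
  set G₁ := momentRate R k d.ρ₀ d.V₀
  have hGd : ∀ s ∈ Ioo 0 τ, HasDerivAt (fun s => moment R k (u.ρ s) - (G₁ * s - B * N * s ^ 2))
      (-2 * B * H s - (G₁ * 1 - B * N * (2 * s))) s := fun s hs => by
    have h1 : HasDerivAt (fun s : ℝ => s ^ 2) (2 * s) s := by simpa using hasDerivAt_pow 2 s
    exact (h.hasDerivAt_moment hout hr hs).sub
      (((hasDerivAt_id s).const_mul G₁).sub (h1.const_mul (B * N)))
  have hanti : AntitoneOn (fun s => moment R k (u.ρ s) - (G₁ * s - B * N * s ^ 2)) (Ico 0 τ) := by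
    refine antitoneOn_of_deriv_nonpos (convex_Ico 0 τ)
      ((h.continuousOn_moment hout hr).sub (Continuous.continuousOn (by fun_prop))) ?_ ?_
    · rw [interior_Ico]
      exact fun s hs => (hGd s hs).differentiableAt.differentiableWithinAt
    · rw [interior_Ico]
      intro s hs
      rw [(hGd s hs).deriv, hG₁]
      have := hHmono h0 (Ioo_subset_Ico_self hs) hs.1.le
      simp only [mul_zero, sub_zero] at this
      nlinarith
  have := hanti h0 ht ht.1
  simp only [mul_zero, sub_zero, ne_eq, OfNat.ofNat_ne_zero, not_false_eq_true, zero_pow,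
    show u.ρ 0 = d.ρ₀ from funext h.init_ρ] at this
  linarith

end IsClassicalSolution

/-- A flow that is at rest outside the ball of radius `R` and stays smooth inside it stays
smooth everywhere. -/
theorem smoothUpTo_univ_of_restOutside (hτ : 0 < τ)
    (hout : RestOutside ρbar pbar r τ u) (hr : r < R)
    (hw : SmoothUpTo u τ (Metric.closedBall 0 R)) : SmoothUpTo u τ univ := by
  obtain ⟨w, hwρ, hwV, hwp, hwu⟩ := hw
  have glue : ∀ {E : Type} [NormedAddCommGroup E] [NormedSpace ℝ E] (f g : ℝ → Sp n → E) (c : E),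
      ContDiffOn ℝ 1 (fun z : ℝ × Sp n => f z.1 z.2) (Icc 0 τ ×ˢ Metric.closedBall 0 R) →
      (∀ t ∈ Ico 0 τ, ∀ x ∈ Metric.closedBall (0 : Sp n) R, f t x = g t x) →
      (∀ t ∈ Ico 0 τ, ∀ x, x ∉ Metric.closedBall (0 : Sp n) r → g t x = c) →
      ContDiffOn ℝ 1 (fun z : ℝ × Sp n => if ‖z.2‖ ≤ R then f z.1 z.2 else c)
        (Icc 0 τ ×ˢ univ) ∧
      ∀ t ∈ Ico 0 τ, ∀ x ∈ univ, (if ‖x‖ ≤ R then f t x else c) = g t x := by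
    intro E _ _ f g c hf hfg hgc
    have hfc : ∀ t ∈ Icc 0 τ, ∀ x ∈ Metric.closedBall (0 : Sp n) R,
        x ∉ Metric.closedBall (0 : Sp n) r → f t x = c := by
      intro t ht x hxR hxr
      rcases ht.2.eq_or_lt with rfl | htτ
      · refine eq_of_continuousOn_Icc (g := fun s => f s x) hτ ?_ fun s hs => ?_
        · exact hf.continuousOn.comp (f := fun s : ℝ => (s, x)) (by fun_prop)
            fun s hs => ⟨hs, hxR⟩
        · rw [hfg s (Ioo_subset_Ico_self hs) x hxR, hgc s (Ioo_subset_Ico_self hs) x hxr]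
      · rw [hfg t ⟨ht.1, htτ⟩ x hxR, hgc t ⟨ht.1, htτ⟩ x hxr]
    refine ⟨fun z hz => ?_, fun t ht x _ => ?_⟩
    · rcases lt_or_ge ‖z.2‖ R with hzR | hzR
      · have hopen : IsOpen {y : ℝ × Sp n | ‖y.2‖ < R} := isOpen_lt (by fun_prop) continuous_const
        have hn : {y : ℝ × Sp n | ‖y.2‖ < R} ∈ 𝓝 z := hopen.mem_nhds hzR
        rw [← contDiffWithinAt_inter hn]
        refine ((hf z ⟨hz.1, by simpa using hzR.le⟩).mono ?_).congr ?_ ?_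
        · exact fun y hy => ⟨hy.1.1, by simpa using (show ‖y.2‖ < R from hy.2).le⟩
        · exact fun y hy => if_pos (show ‖y.2‖ < R from hy.2).le
        · exact if_pos hzR.le
      · have hopen : IsOpen {y : ℝ × Sp n | r < ‖y.2‖} := isOpen_lt continuous_const (by fun_prop)
        have hn : {y : ℝ × Sp n | r < ‖y.2‖} ∈ 𝓝 z := hopen.mem_nhds (hr.trans_le hzR)
        rw [← contDiffWithinAt_inter hn]
        have hc : ∀ y ∈ (Icc 0 τ ×ˢ univ) ∩ {y : ℝ × Sp n | r < ‖y.2‖},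
            (if ‖y.2‖ ≤ R then f y.1 y.2 else c) = c := fun y hy => by
          split_ifs with hyR
          · exact hfc y.1 hy.1.1 y.2 (by simpa using hyR)
              (by simpa using (show r < ‖y.2‖ from hy.2))
          · rfl
        exact contDiffWithinAt_const.congr hc (hc z ⟨hz, hr.trans_le hzR⟩)
    · split_ifs with hxR
      · exact hfg t ht x (by simpa using hxR)
      · exact (hgc t ht x (by simpa using hr.trans (not_le.1 hxR))).symm
  obtain ⟨a1, b1⟩ := glue w.ρ u.ρ ρbar hwρ (fun t ht x hx => (hwu t ht x hx).1)
    fun t ht x hx => (hout t ht x hx).1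
  obtain ⟨a2, b2⟩ := glue w.V u.V 0 hwV (fun t ht x hx => (hwu t ht x hx).2.1)
    fun t ht x hx => (hout t ht x hx).2.1
  obtain ⟨a3, b3⟩ := glue w.p u.p pbar hwp (fun t ht x hx => (hwu t ht x hx).2.2)
    fun t ht x hx => (hout t ht x hx).2.2
  exact ⟨⟨fun t x => if ‖x‖ ≤ R then w.ρ t x else ρbar, fun t x => if ‖x‖ ≤ R then w.V t x else 0,
    w.S, fun t x => if ‖x‖ ≤ R then w.p t x else pbar⟩, a1, a2, a3,
    fun t ht x hx => ⟨b1 t ht x hx, b2 t ht x hx, b3 t ht x hx⟩⟩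

/-- `T₁` is a root of the quadratic majorant of the moment. -/
theorem quadratic_T₁_eq_zero {B N G₀ G₁ : ℝ} (hB : 0 < B) (hdisc : 0 ≤ disc B N G₀ G₁)
    (hpos : 0 < T₁ B N G₀ G₁) :
    G₀ + G₁ * T₁ B N G₀ G₁ - B * N * T₁ B N G₀ G₁ ^ 2 = 0 := by
  rcases eq_or_ne N 0 with rfl | hN
  · rw [T₁, if_pos rfl] at hpos ⊢
    have hG₁ : G₁ ≠ 0 := by
      rintro rfl
      simp at hpos
    field_simp
    ring
  · rw [T₁, if_neg hN]
    have hsq := Real.sq_sqrt hdisc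
    set q := Real.sqrt (disc B N G₀ G₁)
    rw [disc] at hsq
    field_simp
    linear_combination (-1 : ℝ) * hsq

namespace IsClassicalSolution

/-- A classical solution does not exist up to the time `T₁`. -/
theorem lifespan_lt (h : IsClassicalSolution γ τ d u) (hn : 1 ≤ n) (hγ : 1 < γ) (hρ : 0 < ρbar)
    (hp : 0 < pbar) (hR : 0 < R) (hk : 1 < k) (hR₀ : 0 < R₀) (hR₀k : R₀ < R - R / k)
    (hd : IsPerturbation ρbar pbar R₀ d) {T : ℝ} (hT : 0 < T)
    (hTR : R₀ + soundSpeed γ ρbar pbar * T ≤ R - R / k)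
    (hroot : moment R k d.ρ₀ + momentRate R k d.ρ₀ d.V₀ * T
      - Bc R k * Nc γ pbar R₀ R k d * T ^ 2 = 0) : τ < T := by
  by_contra! hτ
  have hσ0 : 0 < soundSpeed γ ρbar pbar := Real.sqrt_pos.2 (by positivity)
  obtain ⟨c, hc0, hc⟩ := exists_moment_lower_bound (k := k) hn hR hk hρ
  have hle : ∀ t ∈ Ioo 0 T, c ≤ moment R k d.ρ₀ + momentRate R k d.ρ₀ d.V₀ * t
      - Bc R k * Nc γ pbar R₀ R k d * t ^ 2 := by
    intro t ht
    obtain ⟨s, hts, hsT⟩ := exists_between ht.2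
    have hs := h.mono (hsT.le.trans hτ)
    have hout := hs.restOutside hγ hρ hp hd
    have hr : R₀ + soundSpeed γ ρbar pbar * s < R - R / k := by nlinarith
    have hts' : t ∈ Ico 0 s := ⟨ht.1.le, hts⟩
    refine le_trans (hc _ (contDiff_slice hs.smooth_ρ hts').continuous ?_ ?_)
      (hs.moment_le hγ hρ hp hR hk hR₀ hR₀k hd hout hr hts')
    · exact fun x => (hs.density_pos hγ hρ hp hR₀ hd hts' x).le
    · intro x hx
      refine (hout t hts' x ?_).1
      rw [mem_closedBall_zero_iff, not_le]
      exact hr.trans_le hx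
  have hlim : Tendsto (fun t : ℝ => moment R k d.ρ₀ + momentRate R k d.ρ₀ d.V₀ * t
      - Bc R k * Nc γ pbar R₀ R k d * t ^ 2) (𝓝[<] T) (𝓝 0) := by
    rw [← hroot]
    exact (Continuous.tendsto (by fun_prop) T).mono_left nhdsWithin_le_nhds
  have := ge_of_tendsto hlim (by
    filter_upwards [Ioo_mem_nhdsLT hT] with t ht
    exact hle t ht)
  linarith

end IsClassicalSolution

end Blowup

end EulerMoment

theorem theorem3 (n : ℕ) (hn : 1 ≤ n) (γ : ℝ) (hγ : 1 < γ)
    (ρbar pbar R₀ R k : ℝ) (hρbar : 0 < ρbar) (hpbar : 0 < pbar)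
    (hR₀ : 0 < R₀) (hR : 0 < R) (hk : (n : ℝ) < k) (hR₀R : R₀ < (k - 1) * R / k)
    (d : EulerMoment.Data n) (hd : EulerMoment.IsPerturbation ρbar pbar R₀ d)
    (B N G₀ G₁ T₁ T₂ : ℝ)
    (hB : B = EulerMoment.Bc R k)
    (hN : N = EulerMoment.Nc γ pbar R₀ R k d)
    (hG₀ : G₀ = EulerMoment.moment R k d.ρ₀)
    (hG₁ : G₁ = EulerMoment.momentRate R k d.ρ₀ d.V₀)
    (hT₁ : T₁ = EulerMoment.T₁ B N G₀ G₁)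
    (hT₂ : T₂ = EulerMoment.T₂ (EulerMoment.soundSpeed γ ρbar pbar) R₀ R k)
    (hdisc : 0 ≤ EulerMoment.disc B N G₀ G₁)
    (hpos : 0 < T₁) (hle : T₁ ≤ T₂) :
    -- `G₁` is the time derivative at `0` of the moment along every solution
    (∀ τ : ℝ, 0 < τ → ∀ u : EulerMoment.Flow n, EulerMoment.IsClassicalSolution γ τ d u →
      HasDerivWithinAt (fun t => EulerMoment.moment R k (u.ρ t)) G₁ (Set.Ici 0) 0) ∧
    -- no smooth solution exists beyond `T₁`
    (∀ τ : ℝ, 0 < τ → ∀ u : EulerMoment.Flow n, EulerMoment.IsClassicalSolution γ τ d u →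
      τ ≤ T₁) ∧
    -- a solution that is smooth before `T₁` cannot stay smooth in the ball up to `T₁`
    (∀ u : EulerMoment.Flow n, EulerMoment.IsClassicalSolution γ T₁ d u →
      ¬ EulerMoment.SmoothUpTo u T₁ (Metric.closedBall 0 R)) ∧
    -- whenever smoothness is lost at a time `τ`, it is lost inside the ball
    (∀ τ : ℝ, 0 < τ → ∀ u : EulerMoment.Flow n, EulerMoment.IsClassicalSolution γ τ d u →
      ¬ EulerMoment.SmoothUpTo u τ Set.univ →
      ¬ EulerMoment.SmoothUpTo u τ (Metric.closedBall 0 R)) := by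
  have hk1 : 1 < k := lt_of_le_of_lt (by exact_mod_cast hn) hk
  have hkR : (k - 1) * R / k = R - R / k := by field_simp
  have hσ0 : 0 < EulerMoment.soundSpeed γ ρbar pbar := Real.sqrt_pos.2 (by positivity)
  rw [hkR] at hR₀R
  have hTR : R₀ + EulerMoment.soundSpeed γ ρbar pbar * T₁ ≤ R - R / k := by
    rw [hT₂, EulerMoment.T₂, hkR, one_div, ← div_eq_inv_mul, le_div_iff₀ hσ0] at hle
    linarith
  have hroot : G₀ + G₁ * T₁ - B * N * T₁ ^ 2 = 0 := by
    rw [hT₁] at hpos ⊢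
    exact EulerMoment.quadratic_T₁_eq_zero (hB ▸ EulerMoment.Bc_pos hR hk1) hdisc hpos
  have hlife : ∀ τ : ℝ, ∀ u : EulerMoment.Flow n,
      EulerMoment.IsClassicalSolution γ τ d u → τ < T₁ := fun τ u h =>
    h.lifespan_lt hn hγ hρbar hpbar hR hk1 hR₀ hR₀R hd hpos hTR
      (by rw [← hG₀, ← hG₁, ← hB, ← hN]; exact hroot)
  have hrest : ∀ τ : ℝ, ∀ u : EulerMoment.Flow n, EulerMoment.IsClassicalSolution γ τ d u →
      R₀ + EulerMoment.soundSpeed γ ρbar pbar * τ < R - R / k := fun τ u h =>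
    lt_of_lt_of_le (by gcongr; exact hlife τ u h) hTR
  refine ⟨fun τ hτ u h => ?_, fun τ _ u h => (hlife τ u h).le,
    fun u h _ => lt_irrefl _ (hlife T₁ u h), fun τ hτ u h hnot hball => hnot ?_⟩
  · rw [hG₁]
    exact h.hasDerivWithinAt_moment hτ hd hR₀R (h.restOutside hγ hρbar hpbar hd) (hrest τ u h)
  · refine EulerMoment.smoothUpTo_univ_of_restOutside hτ (h.restOutside hγ hρbar hpbar hd) ?_ hball
    have : 0 < R / k := by positivity
    linarith [hrest τ u h]
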